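/- Let $\mathbb{T}=\{w_1+i_2w_2 : w_1,w_2\in\mathbb{C}=\mathbb{R}(i_1)\}$ be the commutative ring of bicomplex numbers ($i_1^2=i_2^2=-1$, $j=i_1i_2=i_2i_1$), write $z=x_0+i_1x_1+i_2x_2+jx_3$ with $\operatorname{Re}(z)=x_0$, $\operatorname{Im}_j(z)=x_3$, and let $z=z_1e_1+z_2e_2$ be the idempotent representation, $e_1=\frac{1+i_1i_2}{2}$, $e_2=\frac{1-i_1i_2}{2}$, $z_1=w_1-i_1w_2$, $z_2=w_1+i_1w_2$. Gamma functions, principal powers, and reciprocals are taken in the idempotent components, with $1/\Gamma$ read as an entire function. The bicomplex Prabhakar function is $$E^{\delta}_{\varsigma,\tau}(z)=\sum_{k=0}^{\infty}\frac{(\delta)_k}{k!\,\Gamma(\varsigma k+\tau)}z^k,\qquad (\delta)_k=\delta(\delta+1)\cdots(\delta+k-1).$$ Theorem (bicomplex Mellin transform). Let $\varsigma>0$ be real and let $\zeta,\lambda,\tau,\delta\in\mathbb{T}$ with $|\operatorname{Im}_j(\delta)|<\operatorname{Re}(\delta)$, and, for $r=1,2$, $0<\operatorname{Re}(\zeta_r)<\operatorname{Re}(\delta_r)$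 and $\lambda_r\in\mathbb{C}\setminus(-\infty,0]$. Consider $$\int_0^\infty t^{\zeta-1}E^{\delta}_{\varsigma,\tau}(-\lambda t)\,dt=\frac{\Gamma(\zeta)\Gamma(\delta-\zeta)}{\Gamma(\delta)\Gamma(\tau-\varsigma\zeta)}\lambda^{-\zeta}.\qquad(*)$$ (i) Whenever the improper integral $\lim_{R\to\infty}\int_0^R t^{\zeta-1}E^{\delta}_{\varsigma,\tau}(-\lambda t)\,dt$ converges in $\mathbb{T}$, its value is the right-hand side of $(*)$. (ii) If $|\arg\lambda_r|<(1-\frac{\varsigma}{2})\pi$ for $r=1,2$ (which forces $\varsigma<2$), then the integral converges absolutely and $(*)$ holds. -/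

import Mathlib

/-- Bicomplex numbers `w₁ + i₂ w₂` with `w₁ w₂ : ℂ = ℝ(i₁)`, `i₂² = -1`, `i₁ i₂ = i₂ i₁`. -/
@[ext]
structure Bicomplex where
  w₁ : ℂ
  w₂ : ℂ

namespace Bicomplex

noncomputable section

instance : Zero Bicomplex := ⟨⟨0, 0⟩⟩
instance : One Bicomplex := ⟨⟨1, 0⟩⟩
instance : Add Bicomplex := ⟨fun z w => ⟨z.w₁ + w.w₁, z.w₂ + w.w₂⟩⟩
instance : Neg Bicomplex := ⟨fun z => ⟨-z.w₁, -z.w₂⟩⟩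
instance : Mul Bicomplex :=
  ⟨fun z w => ⟨z.w₁ * w.w₁ - z.w₂ * w.w₂, z.w₁ * w.w₂ + z.w₂ * w.w₁⟩⟩
instance : SMul ℝ Bicomplex := ⟨fun r z => ⟨(r : ℂ) * z.w₁, (r : ℂ) * z.w₂⟩⟩

@[simp] theorem w₁_zero : (0 : Bicomplex).w₁ = 0 := rfl
@[simp] theorem w₂_zero : (0 : Bicomplex).w₂ = 0 := rfl
@[simp] theorem w₁_one : (1 : Bicomplex).w₁ = 1 := rfl
@[simp] theorem w₂_one : (1 : Bicomplex).w₂ = 0 := rfl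
@[simp] theorem w₁_add (z w : Bicomplex) : (z + w).w₁ = z.w₁ + w.w₁ := rfl
@[simp] theorem w₂_add (z w : Bicomplex) : (z + w).w₂ = z.w₂ + w.w₂ := rfl
@[simp] theorem w₁_neg (z : Bicomplex) : (-z).w₁ = -z.w₁ := rfl
@[simp] theorem w₂_neg (z : Bicomplex) : (-z).w₂ = -z.w₂ := rfl
@[simp] theorem w₁_mul (z w : Bicomplex) : (z * w).w₁ = z.w₁ * w.w₁ - z.w₂ * w.w₂ := rfl
@[simp] theorem w₂_mul (z w : Bicomplex) : (z * w).w₂ = z.w₁ * w.w₂ + z.w₂ * w.w₁ := rfl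
@[simp] theorem w₁_smul (r : ℝ) (z : Bicomplex) : (r • z).w₁ = (r : ℂ) * z.w₁ := rfl
@[simp] theorem w₂_smul (r : ℝ) (z : Bicomplex) : (r • z).w₂ = (r : ℂ) * z.w₂ := rfl

instance : CommRing Bicomplex where
  add_assoc a b c := by ext1 <;> simp [add_assoc]
  zero_add a := by ext1 <;> simp
  add_zero a := by ext1 <;> simp
  add_comm a b := by ext1 <;> simp [add_comm]
  neg_add_cancel a := by ext1 <;> simp
  left_distrib a b c := by ext1 <;> simp <;> ring
  right_distrib a b c := by ext1 <;> simp <;> ring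
  zero_mul a := by ext1 <;> simp
  mul_zero a := by ext1 <;> simp
  mul_assoc a b c := by ext1 <;> simp <;> ring
  one_mul a := by ext1 <;> simp
  mul_one a := by ext1 <;> simp
  mul_comm a b := by ext1 <;> simp <;> ring
  nsmul := nsmulRec
  zsmul := zsmulRec

instance : Module ℝ Bicomplex where
  one_smul a := by ext1 <;> simp
  mul_smul r s a := by ext1 <;> simp [mul_assoc]
  smul_zero r := by ext1 <;> simp
  smul_add r a b := by ext1 <;> simp [mul_add]
  add_smul r s a := by ext1 <;> simp [add_mul]
  zero_smul a := by ext1 <;> simp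

/-- The identification of the bicomplex numbers with the Euclidean space `ℂ² = ℝ⁴`. -/
def toEuclidean : Bicomplex →ₗ[ℝ] WithLp 2 (ℂ × ℂ) where
  toFun z := WithLp.toLp 2 (z.w₁, z.w₂)
  map_add' _ _ := rfl
  map_smul' _ _ := rfl

theorem toEuclidean_injective : Function.Injective toEuclidean := by
  intro z w h
  have h' : (z.w₁, z.w₂) = (w.w₁, w.w₂) := congrArg WithLp.ofLp h
  exact Bicomplex.ext (Prod.mk.inj h').1 (Prod.mk.inj h').2

/-- The Euclidean norm `√(|w₁|² + |w₂|²)`. -/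
instance : NormedAddCommGroup Bicomplex :=
  NormedAddCommGroup.induced Bicomplex (WithLp 2 (ℂ × ℂ)) toEuclidean toEuclidean_injective

instance : NormedSpace ℝ Bicomplex :=
  NormedSpace.induced ℝ Bicomplex (WithLp 2 (ℂ × ℂ)) toEuclidean

/-- The real component `x₀` of `x₀ + i₁ x₁ + i₂ x₂ + j x₃`, `j = i₁ i₂`. -/
def re (z : Bicomplex) : ℝ := z.w₁.re

/-- The component `x₃` of `x₀ + i₁ x₁ + i₂ x₂ + j x₃`, `j = i₁ i₂`. -/
def imj (z : Bicomplex) : ℝ := z.w₂.im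

/-- The complex numbers `ℝ(i₁)` inside the bicomplex numbers. -/
def ofComplex (c : ℂ) : Bicomplex := ⟨c, 0⟩

instance : Coe ℝ Bicomplex := ⟨fun r => ofComplex (r : ℂ)⟩

/-- The idempotent `(1 + i₁ i₂) / 2`. -/
def e₁ : Bicomplex := ⟨1 / 2, Complex.I / 2⟩

/-- The idempotent `(1 - i₁ i₂) / 2`. -/
def e₂ : Bicomplex := ⟨1 / 2, -Complex.I / 2⟩

/-- First idempotent component: `w₁ + i₂ w₂ ↦ w₁ - i₁ w₂`. -/
def P₁ (z : Bicomplex) : ℂ := z.w₁ - Complex.I * z.w₂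

/-- Second idempotent component: `w₁ + i₂ w₂ ↦ w₁ + i₁ w₂`. -/
def P₂ (z : Bicomplex) : ℂ := z.w₁ + Complex.I * z.w₂

/-- The bicomplex number `a e₁ + b e₂`. -/
def idem (a b : ℂ) : Bicomplex := ofComplex a * e₁ + ofComplex b * e₂

@[simp] theorem P₁_idem (a b : ℂ) : P₁ (idem a b) = a := by
  simp only [P₁, idem, ofComplex, e₁, e₂, w₁_add, w₂_add, w₁_mul, w₂_mul]
  linear_combination (-(a - b) / 2) * Complex.I_mul_I

@[simp] theorem P₂_idem (a b : ℂ) : P₂ (idem a b) = b := by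
  simp only [P₂, idem, ofComplex, e₁, e₂, w₁_add, w₂_add, w₁_mul, w₂_mul]
  linear_combination ((a - b) / 2) * Complex.I_mul_I

/-- The idempotent representation `z = P₁(z) e₁ + P₂(z) e₂`. -/
theorem idem_P (z : Bicomplex) : idem (P₁ z) (P₂ z) = z := by
  ext1 <;> simp only [P₁, P₂, idem, ofComplex, e₁, e₂, w₁_add, w₂_add, w₁_mul, w₂_mul]
  · ring
  · linear_combination (-z.w₂) * Complex.I_mul_I

/-- The reciprocal, taken in each idempotent component; off the null cone this is the ring
inverse. Applied to `Gamma` it gives the values of the entire function `1 / Γ` (which is `0` in a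
component where `Γ` has a pole, as `Complex.Gamma` is `0` there and `0⁻¹ = 0`). -/
instance : Inv Bicomplex := ⟨fun z => idem (P₁ z)⁻¹ (P₂ z)⁻¹⟩

instance : Div Bicomplex := ⟨fun z w => z * w⁻¹⟩

/-- The bicomplex gamma function `Γ(z₁ e₁ + z₂ e₂) = Γ(z₁) e₁ + Γ(z₂) e₂`. -/
def Gamma (z : Bicomplex) : Bicomplex := idem (Complex.Gamma (P₁ z)) (Complex.Gamma (P₂ z))

/-- The (principal) bicomplex power `z ^ w = exp (w log z) = z₁ ^ w₁ e₁ + z₂ ^ w₂ e₂`, in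
idempotent components. -/
instance : Pow Bicomplex Bicomplex := ⟨fun z w => idem (P₁ z ^ P₁ w) (P₂ z ^ P₂ w)⟩

/-- The bicomplex Prabhakar (three-parameter Mittag-Leffler) function
`∑ (δ)_k / (k! Γ(ς k + τ)) z ^ k`, with `(δ)_k = δ (δ + 1) ⋯ (δ + k - 1)`. -/
def prabhakar (ς τ δ z : Bicomplex) : Bicomplex :=
  ∑' k : ℕ, (∏ i ∈ Finset.range k, (δ + (i : Bicomplex))) /
    ((k.factorial : Bicomplex) * Gamma (ς * (k : Bicomplex) + τ)) * z ^ k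

end

end Bicomplex

/-!
The idempotent components are continuous ring homomorphisms to `ℂ` that together form a linear
homeomorphism with `ℂ × ℂ`, so everything reduces to one complex component, with the entire function
`E(z) = ∑ a_k z ^ k`, `a_k = (δ)_k / (k! Γ(ςk + τ))`, and a scale `l` in the slit plane.

**The generating function.** Smoothing `E(-l ·)` by an exponential kernel replaces `a_k` by
`a_k Γ(ςk + τ + m) = (δ)_k / k! · (ςk + τ)_m`. The resulting series `h(y)` is a finite combination
of the powers `(1 + l y) ^ (-δ - j)` (`exists_generating_function`), hence analytic along the whole
positive axis, with Mellin transform `(τ - ςs)_m Γ(s) Γ(δ - s) / Γ(δ) · l ^ (-s)`. The integer `m`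
is only there to make Laplace integrals converge at the origin. Since
`1 / Γ(τ - ςs) = (τ - ςs)_m / Γ(τ + m - ςs)` for the entire function `1 / Γ`, it disappears from
the final formula.

**Value of a convergent improper integral** (`value_of_tendsto`). Let
`F(R) = ∫_0^R t ^ (ζ - 1) E(-l t) dt` and `σ = τ + m - ςζ`. For large `x`, termwise integration gives
`x ^ σ ∫_0^∞ e ^ (-x v) v ^ (σ - 1) F(v ^ ς) dv = ∫_0^{x ^ (-ς)} y ^ (ζ - 1) h(y) dy`.
If `F` converges, it is bounded, so the left side is analytic for `Re x > 0`, and the identity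
persists for all `x > 0` (`eqOn_Ioi_of_eventually_eq`). As `x → 0`, the left side tends to
`Γ(σ) lim F` (`tendsto_cpow_mul_laplace`) and the right side to the Mellin transform of `h` at `ζ`.
No asymptotics of `E` are needed, so this also covers conditional convergence.

**Absolute convergence in the sector.** There the symbol
`Γ(s) Γ(δ - s) / (Γ(δ) Γ(τ - ςs)) · l ^ (-s)` decays exponentially on vertical lines
(`exists_norm_mellinSymbol_le`), and its inverse Mellin transform along `Re s = c` is
`O(t ^ (-c))`. It has the same Laplace-type transform as `E(-l ·)`, namely `h`, so the two functions
coincide by injectivity of the Laplace transform (`prabhakarC_eq_mellinInv`). A line with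
`Re ζ < c < Re δ` gives integrability at infinity.
-/

namespace PrabhakarMellin

open Complex MeasureTheory Set Filter Topology

/-! ### Bounds for the Gamma function on vertical lines -/

theorem norm_Gamma_half_sq (η : ℝ) :
    ‖Gamma (1 / 2 + η * I)‖ ^ 2 = Real.pi / Real.cosh (Real.pi * η) := by
  have h := Complex.Gamma_mul_Gamma_one_sub (1 / 2 + η * I)
  have hc : (1 : ℂ) - (1 / 2 + η * I) = (starRingEnd ℂ) (1 / 2 + η * I) := by
    apply Complex.ext <;> simp
    norm_num
  have hs : Complex.sin (Real.pi * (1 / 2 + η * I)) = (Real.cosh (Real.pi * η) : ℝ) := by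
    rw [show (Real.pi : ℂ) * (1 / 2 + η * I) = (Real.pi * η : ℂ) * I + Real.pi / 2 by ring,
      Complex.sin_add_pi_div_two, Complex.cos_mul_I]
    push_cast
    rfl
  rw [hc, Gamma_conj, hs, Complex.mul_conj, Complex.normSq_eq_norm_sq] at h
  exact_mod_cast h

theorem norm_Gamma_half_ge (η : ℝ) :
    √Real.pi * Real.exp (-(Real.pi / 2 * |η|)) ≤ ‖Gamma (1 / 2 + η * I)‖ := by
  refine le_of_sq_le_sq ?_ (norm_nonneg _)
  rw [norm_Gamma_half_sq, mul_pow, Real.sq_sqrt Real.pi_pos.le, ← Real.exp_nat_mul,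
    show ((2 : ℕ) : ℝ) * -(Real.pi / 2 * |η|) = -(Real.pi * |η|) by push_cast; ring, Real.exp_neg,
    div_eq_mul_inv]
  refine mul_le_mul_of_nonneg_left ?_ Real.pi_pos.le
  have hcosh : Real.cosh (Real.pi * η) ≤ Real.exp (Real.pi * |η|) := by
    rw [← Real.cosh_abs, abs_mul, abs_of_pos Real.pi_pos, Real.cosh_eq]
    have : Real.exp (-(Real.pi * |η|)) ≤ Real.exp (Real.pi * |η|) := by
      apply Real.exp_le_exp.2
      have : 0 ≤ Real.pi * |η| := by positivity
      linarith
    linarith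
  exact inv_anti₀ (Real.cosh_pos _) hcosh

theorem norm_betaIntegral_le (u v : ℂ) :
    ‖betaIntegral u v‖ ≤ ‖betaIntegral (u.re : ℂ) (v.re : ℂ)‖ := by
  have key : ∀ a b : ℂ, ∀ x ∈ Ioo (0 : ℝ) 1, ‖(x : ℂ) ^ (a - 1) * (1 - (x : ℂ)) ^ (b - 1)‖
      = x ^ (a.re - 1) * (1 - x) ^ (b.re - 1) := by
    intro a b x hx
    rw [norm_mul, norm_cpow_eq_rpow_re_of_pos hx.1]
    have : (1 - (x : ℂ)) = ((1 - x : ℝ) : ℂ) := by push_cast; rfl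
    rw [this, norm_cpow_eq_rpow_re_of_pos (by linarith [hx.2])]
    simp
  have h0 : betaIntegral (u.re : ℂ) (v.re : ℂ)
      = ((∫ x in Ioo (0 : ℝ) 1, x ^ (u.re - 1) * (1 - x) ^ (v.re - 1) : ℝ) : ℂ) := by
    rw [betaIntegral, intervalIntegral.integral_of_le zero_le_one, integral_Ioc_eq_integral_Ioo]
    refine Eq.trans ?_ integral_ofReal
    refine setIntegral_congr_fun measurableSet_Ioo fun x hx => ?_
    simp only [coe_algebraMap, ofReal_mul]
    rw [ofReal_cpow hx.1.le, ofReal_cpow (by linarith [hx.2])]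
    push_cast
    rfl
  rw [h0, norm_real, Real.norm_eq_abs]
  refine le_trans ?_ (le_abs_self _)
  rw [betaIntegral, intervalIntegral.integral_of_le zero_le_one, integral_Ioc_eq_integral_Ioo]
  refine (norm_integral_le_integral_norm _).trans (le_of_eq ?_)
  exact setIntegral_congr_fun measurableSet_Ioo fun x hx => key u v x hx

/-- Since `|B(x - 1/2, 1/2 + iη)| ≤ B(x - 1/2, 1/2)`, the decay of `Γ` on the line of real part
`1/2`, which the reflection formula gives exactly, is the worst possible one further right. -/
theorem norm_Gamma_ge {x : ℝ} (hx : 1 / 2 < x) (η : ℝ) :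
    Real.Gamma x * Real.exp (-(Real.pi / 2 * |η|)) ≤ ‖Gamma (x + η * I)‖ := by
  have h12 : (0 : ℝ) < (1 / 2 + η * I : ℂ).re := by simp
  have hx2 : (0 : ℝ) < ((x - 1 / 2 : ℝ) : ℂ).re := by rw [ofReal_re]; linarith
  have hB := norm_betaIntegral_le ((x - 1 / 2 : ℝ) : ℂ) (1 / 2 + η * I)
  have e1 : ((1 / 2 + η * I : ℂ).re : ℂ) = ((1 / 2 : ℝ) : ℂ) := by simp
  rw [ofReal_re, e1, betaIntegral_eq_Gamma_mul_div _ _ hx2 h12,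
    betaIntegral_eq_Gamma_mul_div _ _ hx2 (by norm_num), ← ofReal_add, Complex.Gamma_ofReal,
    Complex.Gamma_ofReal, Complex.Gamma_ofReal, Real.Gamma_one_half_eq] at hB
  have e2 : ((x - 1 / 2 : ℝ) : ℂ) + (1 / 2 + η * I) = x + η * I := by push_cast; ring
  rw [e2] at hB
  have e3 : x - 1 / 2 + 1 / 2 = x := by ring
  have hGx : 0 < Real.Gamma x := Real.Gamma_pos_of_pos (by linarith)
  have hGx2 : 0 < Real.Gamma (x - 1 / 2) := Real.Gamma_pos_of_pos (by linarith)
  have hG : 0 < ‖Gamma (x + η * I)‖ :=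
    norm_pos_iff.2 (Gamma_ne_zero_of_re_pos (by simp; linarith))
  simp only [norm_div, norm_mul, norm_real, Real.norm_eq_abs, e3, abs_of_pos hGx, abs_of_pos hGx2,
    abs_of_pos (Real.sqrt_pos.2 Real.pi_pos)] at hB
  rw [div_le_div_iff₀ hG hGx, mul_assoc, mul_assoc] at hB
  have hB' := le_of_mul_le_mul_left hB hGx2
  have h3 := norm_Gamma_half_ge η
  have hpi := Real.sqrt_pos.2 Real.pi_pos
  have h4 : √Real.pi * (Real.Gamma x * Real.exp (-(Real.pi / 2 * |η|)))
      ≤ √Real.pi * ‖Gamma (x + η * I)‖ := by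
    refine le_trans ?_ hB'
    calc _ = (√Real.pi * Real.exp (-(Real.pi / 2 * |η|))) * Real.Gamma x := by ring
      _ ≤ _ := mul_le_mul_of_nonneg_right h3 hGx.le
  exact le_of_mul_le_mul_left h4 hpi

theorem exists_norm_linear_le_exp (x : ℝ) {ε : ℝ} (hε : 0 < ε) :
    ∃ C : ℝ, 0 < C ∧ ∀ η : ℝ, ‖(x : ℂ) + η * I‖ ≤ C * Real.exp (ε * |η|) := by
  refine ⟨|x| + 1 / ε, by positivity, fun η => ?_⟩
  have h1 : ‖(x : ℂ) + η * I‖ ≤ |x| + |η| := by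
    refine (norm_add_le _ _).trans ?_
    simp
  have h2 : ε * |η| + 1 ≤ Real.exp (ε * |η|) := Real.add_one_le_exp _
  have h3 : 1 ≤ Real.exp (ε * |η|) := Real.one_le_exp (by positivity)
  have h4 : |η| = 1 / ε * (ε * |η|) := by field_simp
  have h5 : 1 / ε * (ε * |η|) ≤ 1 / ε * Real.exp (ε * |η|) :=
    mul_le_mul_of_nonneg_left (by linarith) (by positivity)
  have h6 : |x| * 1 ≤ |x| * Real.exp (ε * |η|) := mul_le_mul_of_nonneg_left h3 (abs_nonneg x)
  linarith

/-- Upper bound for `1 / Γ` on an arbitrary vertical line; to the left of the region of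
`norm_Gamma_ge` it follows by the functional equation. -/
theorem exists_norm_inv_Gamma_le (x : ℝ) {ε : ℝ} (hε : 0 < ε) :
    ∃ C : ℝ, 0 < C ∧ ∀ η : ℝ,
      ‖(Gamma (x + η * I))⁻¹‖ ≤ C * Real.exp ((Real.pi / 2 + ε) * |η|) := by
  obtain ⟨m, hm⟩ := exists_nat_gt (1 / 2 - x)
  induction m generalizing x ε with
  | zero =>
    have hx : 1 / 2 < x := by simp at hm; linarith
    have hGx : 0 < Real.Gamma x := Real.Gamma_pos_of_pos (by linarith)
    refine ⟨(Real.Gamma x)⁻¹, by positivity, fun η => ?_⟩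
    rw [norm_inv]
    refine (inv_anti₀ (by positivity) (norm_Gamma_ge hx η)).trans ?_
    rw [mul_inv, ← Real.exp_neg, neg_neg]
    refine mul_le_mul_of_nonneg_left (Real.exp_le_exp.2 ?_) (by positivity)
    nlinarith [abs_nonneg η]
  | succ m ih =>
    obtain ⟨C, hC, h⟩ := ih (x + 1) (half_pos hε) (by push_cast at hm; linarith)
    obtain ⟨D, hD, h'⟩ := exists_norm_linear_le_exp x (half_pos hε)
    refine ⟨D * C, by positivity, fun η => ?_⟩
    rw [one_div_Gamma_eq_self_mul_one_div_Gamma_add_one, norm_mul]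
    have e : (x : ℂ) + η * I + 1 = ((x + 1 : ℝ) : ℂ) + η * I := by push_cast; ring
    rw [e]
    refine (mul_le_mul (h' η) (h η) (norm_nonneg _) (by positivity)).trans (le_of_eq ?_)
    rw [mul_mul_mul_comm, ← Real.exp_add]
    ring_nf

theorem norm_Gamma_le_Gamma_re {x : ℝ} (hx : 0 < x) (η : ℝ) :
    ‖Gamma (x + η * I)‖ ≤ Real.Gamma x := by
  rw [Complex.Gamma_eq_integral (by simpa using hx), Real.Gamma_eq_integral hx, GammaIntegral]
  refine (norm_integral_le_integral_norm _).trans (le_of_eq ?_)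
  refine setIntegral_congr_fun measurableSet_Ioi fun t ht => ?_
  simp only [norm_mul, norm_cpow_eq_rpow_re_of_pos (mem_Ioi.1 ht), norm_real, Real.norm_eq_abs,
    abs_of_pos (Real.exp_pos _)]
  simp

theorem abs_sinh_le_norm_sin (a b : ℝ) : |Real.sinh b| ≤ ‖Complex.sin (a + b * I)‖ := by
  have h : ‖Complex.sin (a + b * I)‖ ^ 2 = Real.sin a ^ 2 + Real.sinh b ^ 2 := by
    rw [Complex.sin_add_mul_I, ← Complex.normSq_eq_norm_sq, ← ofReal_sin, ← ofReal_cos,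
      ← ofReal_sinh, ← ofReal_cosh, ← ofReal_mul, ← ofReal_mul, Complex.normSq_add_mul_I]
    have h1 := Real.cosh_sq b
    have h2 := Real.sin_sq_add_cos_sq a
    linear_combination Real.sin a ^ 2 * h1 + Real.sinh b ^ 2 * h2
  rw [← abs_of_nonneg (norm_nonneg (Complex.sin (a + b * I)))]
  apply sq_le_sq.1
  rw [h]
  nlinarith [sq_nonneg (Real.sin a)]

/-- Upper bound for `Γ` in the right half-plane: away from the real axis it is the bound for `1 / Γ`
transported by the reflection formula. -/
theorem exists_norm_Gamma_le {x : ℝ} (hx : 0 < x) {ε : ℝ} (hε : 0 < ε) :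
    ∃ C : ℝ, 0 < C ∧ ∀ η : ℝ,
      ‖Gamma (x + η * I)‖ ≤ C * Real.exp (-((Real.pi / 2 - ε) * |η|)) := by
  obtain ⟨C, hC, h⟩ := exists_norm_inv_Gamma_le (1 - x) hε
  have hGx : 0 < Real.Gamma x := Real.Gamma_pos_of_pos hx
  refine ⟨4 * Real.pi * C + Real.Gamma x * Real.exp (Real.pi / 2), by positivity, fun η => ?_⟩
  rcases le_total 1 |η| with h1 | h1
  · have hsinh : Real.exp (Real.pi * |η|) / 4 ≤ |Real.sinh (Real.pi * η)| := by
      rw [Real.abs_sinh, abs_mul, abs_of_pos Real.pi_pos, Real.sinh_eq]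
      have ha : Real.exp (-(Real.pi * |η|)) ≤ 1 := Real.exp_le_one_iff.2 (by
        have : 0 ≤ Real.pi * |η| := by positivity
        linarith)
      have hb : Real.pi * |η| + 1 ≤ Real.exp (Real.pi * |η|) := Real.add_one_le_exp _
      have : 3 ≤ Real.pi * |η| := by nlinarith [Real.pi_gt_three]
      linarith
    have hsin := abs_sinh_le_norm_sin (Real.pi * x) (Real.pi * η)
    have e : ((Real.pi * x : ℝ) : ℂ) + (Real.pi * η : ℝ) * I = Real.pi * (x + η * I) := by
      push_cast; ring
    rw [e] at hsin
    have hpos : 0 < ‖Complex.sin (Real.pi * (x + η * I))‖ :=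
      lt_of_lt_of_le (by positivity) (hsinh.trans hsin)
    have hne : Gamma (1 - (x + η * I)) ≠ 0 := by
      intro h0
      obtain ⟨n, hn⟩ := (Complex.Gamma_eq_zero_iff _).1 h0
      have := congrArg Complex.im hn
      simp at this
      rw [this] at h1
      norm_num at h1
    have hrefl := Complex.Gamma_mul_Gamma_one_sub (x + η * I)
    have h2 : Gamma (x + η * I) = Real.pi / Complex.sin (Real.pi * (x + η * I))
        * (Gamma (1 - (x + η * I)))⁻¹ := by
      rw [← hrefl, mul_inv_cancel_right₀ hne]
    have e2 : (1 : ℂ) - (x + η * I) = ((1 - x : ℝ) : ℂ) + ((-η : ℝ) : ℂ) * I := by push_cast; ring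
    have h3 := h (-η)
    rw [← e2, abs_neg] at h3
    rw [h2, norm_mul, norm_div, norm_real, Real.norm_eq_abs, abs_of_pos Real.pi_pos]
    calc _ ≤ Real.pi / (Real.exp (Real.pi * |η|) / 4)
          * (C * Real.exp ((Real.pi / 2 + ε) * |η|)) := by
          refine mul_le_mul ?_ h3 (norm_nonneg _) (by positivity)
          exact div_le_div_of_nonneg_left Real.pi_pos.le (by positivity) (hsinh.trans hsin)
      _ = 4 * Real.pi * C * Real.exp (-((Real.pi / 2 - ε) * |η|)) := by
          have : Real.exp ((Real.pi / 2 + ε) * |η|)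
              = Real.exp (Real.pi * |η|) * Real.exp (-((Real.pi / 2 - ε) * |η|)) := by
            rw [← Real.exp_add]; ring_nf
          rw [this]
          field_simp
      _ ≤ _ := by
          refine mul_le_mul_of_nonneg_right ?_ (Real.exp_pos _).le
          have : 0 < Real.Gamma x * Real.exp (Real.pi / 2) := by positivity
          linarith
  · refine (norm_Gamma_le_Gamma_re hx η).trans ?_
    have h2 : 1 ≤ Real.exp (Real.pi / 2) * Real.exp (-((Real.pi / 2 - ε) * |η|)) := by
      rw [← Real.exp_add]
      apply Real.one_le_exp
      nlinarith [abs_nonneg η, Real.pi_pos]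
    have h3 : 0 < 4 * Real.pi * C * Real.exp (-((Real.pi / 2 - ε) * |η|)) := by positivity
    nlinarith [mul_le_mul_of_nonneg_left h2 hGx.le]

theorem rpow_mul_exp_neg_le_Gamma {x R : ℝ} (hx : 1 ≤ x) (hR : 0 < R) :
    R ^ (x - 1) * Real.exp (-R) ≤ Real.Gamma x := by
  have hx0 : 0 < x := by linarith
  rw [Real.Gamma_eq_integral hx0]
  have hint := Real.GammaIntegral_convergent hx0
  have hexp : IntegrableOn (fun t : ℝ => R ^ (x - 1) * Real.exp (-t)) (Ioi R) :=
    (integrableOn_exp_neg_Ioi R).const_mul _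
  calc R ^ (x - 1) * Real.exp (-R) = ∫ t in Ioi R, R ^ (x - 1) * Real.exp (-t) := by
        rw [integral_const_mul, integral_exp_neg_Ioi]
    _ ≤ ∫ t in Ioi R, Real.exp (-t) * t ^ (x - 1) := by
        refine setIntegral_mono_on hexp (hint.mono_set (Ioi_subset_Ioi hR.le)) measurableSet_Ioi
          fun t ht => ?_
        rw [mul_comm]
        exact mul_le_mul_of_nonneg_left
          (Real.rpow_le_rpow hR.le (mem_Ioi.1 ht).le (by linarith)) (Real.exp_pos _).le
    _ ≤ _ := by
        refine setIntegral_mono_set hint ?_ (Ioi_subset_Ioi hR.le).eventuallyLE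
        filter_upwards [ae_restrict_mem measurableSet_Ioi] with t ht
        have := (mem_Ioi.1 ht).le
        positivity

/-! ### Coefficients of the Prabhakar series -/

/-- The rising factorial `a (a + 1) ⋯ (a + k - 1)`. -/
noncomputable def rising (a : ℂ) (k : ℕ) : ℂ := ∏ i ∈ Finset.range k, (a + i)

@[simp] theorem rising_zero (a : ℂ) : rising a 0 = 1 := by simp [rising]

theorem rising_succ (a : ℂ) (k : ℕ) : rising a (k + 1) = rising a k * (a + k) := by
  rw [rising, Finset.prod_range_succ, rising]

theorem rising_add (a : ℂ) (j k : ℕ) : rising a (j + k) = rising a j * rising (a + j) k := by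
  rw [rising, Finset.prod_range_add, rising, rising]
  congr 1
  exact Finset.prod_congr rfl fun i _ => by push_cast; ring

/-- Valid also at the poles of `Γ`, where the left side is zero. -/
theorem inv_Gamma_eq_rising_mul (w : ℂ) (m : ℕ) :
    (Gamma w)⁻¹ = rising w m * (Gamma (w + m))⁻¹ := by
  induction m with
  | zero => simp
  | succ m ih =>
    rw [ih, one_div_Gamma_eq_self_mul_one_div_Gamma_add_one (w + m), rising_succ]
    push_cast
    ring_nf

theorem Gamma_add_nat {w : ℂ} (hw : 0 < w.re) (m : ℕ) :
    Gamma (w + m) = rising w m * Gamma w := by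
  have h := inv_Gamma_eq_rising_mul w m
  have h1 : Gamma w ≠ 0 := Gamma_ne_zero_of_re_pos hw
  have h2 : Gamma (w + m) ≠ 0 := Gamma_ne_zero_of_re_pos (by simp; positivity)
  field_simp at h
  rw [h, mul_comm]

theorem norm_rising_le (a : ℂ) (k : ℕ) : ‖rising a k‖ ≤ k.factorial * (‖a‖ + 1) ^ k := by
  induction k with
  | zero => simp
  | succ k ih =>
    rw [rising_succ, norm_mul, Nat.factorial_succ, pow_succ]
    have h : ‖a + k‖ ≤ (k + 1) * (‖a‖ + 1) := by
      refine (norm_add_le _ _).trans ?_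
      rw [Complex.norm_natCast]
      nlinarith [norm_nonneg a, (Nat.cast_nonneg k : (0 : ℝ) ≤ k)]
    refine (mul_le_mul ih h (norm_nonneg _) (by positivity)).trans (le_of_eq ?_)
    push_cast
    ring

/-- The `k`-th coefficient of the complex Prabhakar series. -/
noncomputable def coeff (ς : ℝ) (τ δ : ℂ) (k : ℕ) : ℂ :=
  rising δ k / (k.factorial * Gamma (ς * k + τ))

theorem coeff_eq (ς : ℝ) (τ δ : ℂ) (m k : ℕ) :
    coeff ς τ δ k
      = rising δ k / k.factorial * rising (ς * k + τ) m * (Gamma (ς * k + (τ + m)))⁻¹ := by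
  rw [coeff, div_eq_mul_inv, mul_inv, inv_Gamma_eq_rising_mul _ m, div_eq_mul_inv, add_assoc]
  ring

theorem coeff_mul_Gamma {ς : ℝ} (hς : 0 < ς) (τ δ : ℂ) {m : ℕ} (hm : 0 < τ.re + m) (k : ℕ) :
    coeff ς τ δ k * Gamma (ς * k + (τ + m)) = rising δ k / k.factorial * rising (ς * k + τ) m := by
  have hne : Gamma (ς * k + (τ + m)) ≠ 0 := Gamma_ne_zero_of_re_pos (by
    simp
    positivity)
  rw [coeff_eq ς τ δ m, inv_mul_cancel_right₀ hne]

theorem exists_norm_rising_le_pow {ς : ℝ} (hς : 0 < ς) (τ : ℂ) (m : ℕ) :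
    ∃ C : ℝ, 0 < C ∧ ∀ k : ℕ, ‖rising (ς * k + τ) m‖ ≤ C * (2 ^ m) ^ k := by
  induction m with
  | zero => exact ⟨1, one_pos, fun k => by simp⟩
  | succ m ih =>
    obtain ⟨C, hC, h⟩ := ih
    refine ⟨C * (ς + ‖τ‖ + m), by positivity, fun k => ?_⟩
    rw [rising_succ, norm_mul]
    have h2 : ‖(ς * k + τ + m : ℂ)‖ ≤ (ς + ‖τ‖ + m) * 2 ^ k := by
      refine (norm_add₃_le).trans ?_
      rw [norm_mul, Complex.norm_natCast, Complex.norm_natCast, norm_real, Real.norm_eq_abs,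
        abs_of_pos hς]
      have h3 : (k : ℝ) ≤ 2 ^ k := by exact_mod_cast Nat.lt_two_pow_self.le
      have h4 : (1 : ℝ) ≤ 2 ^ k := one_le_pow₀ (by norm_num)
      have h5 := mul_le_mul_of_nonneg_left h3 hς.le
      have h6 := mul_le_mul_of_nonneg_left h4 (norm_nonneg τ)
      have h7 := mul_le_mul_of_nonneg_left h4 (Nat.cast_nonneg m : (0 : ℝ) ≤ m)
      linarith
    refine (mul_le_mul (h k) h2 (norm_nonneg _) (by positivity)).trans (le_of_eq ?_)
    rw [pow_succ, mul_pow]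
    ring

/-- The coefficients, multiplied by the Gamma factors that a Laplace transform produces, grow at
most geometrically. -/
theorem exists_norm_coeff_mul_Gamma_le {ς : ℝ} (hς : 0 < ς) (τ δ : ℂ) {m : ℕ}
    (hm : 1 / 2 < τ.re + m) :
    ∃ C K : ℝ, 0 < C ∧ 0 < K ∧ ∀ k : ℕ,
      ‖coeff ς τ δ k‖ * Real.Gamma (ς * k + (τ.re + m)) ≤ C * K ^ k := by
  obtain ⟨C, hC, h⟩ := exists_norm_rising_le_pow hς τ m
  refine ⟨C * Real.exp (Real.pi / 2 * |τ.im|), (‖δ‖ + 1) * 2 ^ m, by positivity, by positivity,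
    fun k => ?_⟩
  have hkς : 0 ≤ ς * k := by positivity
  have hG := norm_Gamma_ge (x := ς * k + (τ.re + m)) (by linarith) τ.im
  have e : ((ς * k + (τ.re + m) : ℝ) : ℂ) + τ.im * I = ς * k + (τ + m) := by
    conv_rhs => rw [← re_add_im τ]
    push_cast
    ring
  rw [e] at hG
  have h1 : ‖coeff ς τ δ k‖ * ‖Gamma (ς * k + (τ + m))‖ ≤ (‖δ‖ + 1) ^ k * (C * (2 ^ m) ^ k) := by
    rw [← norm_mul, coeff_mul_Gamma hς τ δ (by linarith), norm_mul, norm_div, Complex.norm_natCast]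
    refine mul_le_mul ?_ (h k) (norm_nonneg _) (by positivity)
    rw [div_le_iff₀ (by positivity), mul_comm]
    exact norm_rising_le δ k
  have h2 : Real.Gamma (ς * k + (τ.re + m))
      ≤ ‖Gamma (ς * k + (τ + m))‖ * Real.exp (Real.pi / 2 * |τ.im|) := by
    have := mul_le_mul_of_nonneg_right hG (Real.exp_pos (Real.pi / 2 * |τ.im|)).le
    rwa [mul_assoc, ← Real.exp_add, neg_add_cancel, Real.exp_zero, mul_one] at this
  calc _ ≤ ‖coeff ς τ δ k‖ * (‖Gamma (ς * k + (τ + m))‖ * Real.exp (Real.pi / 2 * |τ.im|)) :=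
        mul_le_mul_of_nonneg_left h2 (norm_nonneg _)
    _ ≤ (‖δ‖ + 1) ^ k * (C * (2 ^ m) ^ k) * Real.exp (Real.pi / 2 * |τ.im|) := by
        rw [← mul_assoc]
        exact mul_le_mul_of_nonneg_right h1 (Real.exp_pos _).le
    _ = _ := by rw [mul_pow]; ring

/-- The Prabhakar function is entire: `Γ(ςk + x) ≥ e^{-R} R^{ςk + x - 1}` for every `R`, and a large
`R` beats any geometric growth. -/
theorem summable_norm_coeff_mul_pow {ς : ℝ} (hς : 0 < ς) (τ δ : ℂ) {r : ℝ} (hr : 0 ≤ r) :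
    Summable fun k : ℕ => ‖coeff ς τ δ k‖ * r ^ k := by
  obtain ⟨m, hm⟩ := exists_nat_gt (1 - τ.re)
  obtain ⟨C, K, hC, hK, h⟩ := exists_norm_coeff_mul_Gamma_le hς τ δ (m := m) (by linarith)
  set X := τ.re + m with hX
  have hX1 : 1 ≤ X := by linarith
  -- this choice of `R` makes `K * r / R ^ ς = 1 / 2`
  set R : ℝ := (2 * (K * (r + 1))) ^ (1 / ς) with hR
  have hR0 : 0 < R := by positivity
  have hRς : R ^ ς = 2 * (K * (r + 1)) := by
    rw [hR, ← Real.rpow_mul (by positivity), one_div_mul_cancel hς.ne', Real.rpow_one]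
  have hbound : ∀ k : ℕ, ‖coeff ς τ δ k‖ * r ^ k
      ≤ C * Real.exp R * R ^ (1 - X) * (1 / 2) ^ k := by
    intro k
    have hkς : 0 ≤ ς * k := by positivity
    have hG := rpow_mul_exp_neg_le_Gamma (x := ς * k + X) (by linarith) hR0
    have e1 : R ^ (ς * k + X - 1) = (2 * (K * (r + 1))) ^ k * R ^ (X - 1) := by
      rw [add_sub_assoc, Real.rpow_add hR0, Real.rpow_mul hR0.le, hRς, Real.rpow_natCast]
    rw [e1] at hG
    have h2 := (mul_le_mul_of_nonneg_left hG (norm_nonneg (coeff ς τ δ k))).trans (h k)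
    have e2 : R ^ (1 - X) = (R ^ (X - 1))⁻¹ := by
      rw [← Real.rpow_neg hR0.le, neg_sub]
    have hA : 0 < R ^ (X - 1) := by positivity
    have h3 : ‖coeff ς τ δ k‖ * (r + 1) ^ k
        ≤ C * Real.exp R * R ^ (1 - X) * (1 / 2) ^ k := by
      rw [e2]
      rw [Real.exp_neg, mul_pow, mul_pow] at h2
      have hK' : 0 < K ^ k := by positivity
      rw [one_div, inv_pow]
      have hE := Real.exp_pos R
      field_simp at h2 ⊢
      linarith
    exact (mul_le_mul_of_nonneg_left (pow_le_pow_left₀ hr (by linarith) k)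
      (norm_nonneg _)).trans h3
  refine Summable.of_nonneg_of_le (fun k => by positivity) hbound ?_
  exact (summable_geometric_of_lt_one (by norm_num) (by norm_num)).mul_left _

/-! ### Termwise integration -/

theorem integrable_tsum_of_summable_integral_norm {α : Type*} [MeasurableSpace α] {μ : Measure α}
    {F : ℕ → α → ℂ} (hF_int : ∀ i, Integrable (F i) μ)
    (hF_sum : Summable fun i => ∫ a, ‖F i a‖ ∂μ) : Integrable (fun a => ∑' i, F i a) μ := by
  have hlin : ∫⁻ a, ∑' i, ‖F i a‖ₑ ∂μ ≠ ⊤ := by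
    rw [lintegral_tsum fun i => (hF_int i).1.enorm]
    have h : ∀ i, ∫⁻ a, ‖F i a‖ₑ ∂μ = ENNReal.ofReal (∫ a, ‖F i a‖ ∂μ) := fun i =>
      (ofReal_integral_norm_eq_lintegral_enorm (hF_int i)).symm
    simp_rw [h]
    rw [← ENNReal.ofReal_tsum_of_nonneg (fun i => integral_nonneg fun a => norm_nonneg _) hF_sum]
    exact ENNReal.ofReal_ne_top
  have hmeas : AEMeasurable (fun a => ∑' i, ‖F i a‖ₑ) μ :=
    AEMeasurable.tsum fun i => (hF_int i).1.enorm
  have hsum : ∀ᵐ a ∂μ, Summable fun i => F i a := by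
    filter_upwards [ae_lt_top' hmeas hlin] with a ha
    refine Summable.of_norm ?_
    have : ∑' i, ((‖F i a‖₊ : NNReal) : ENNReal) ≠ ⊤ := ha.ne
    exact NNReal.summable_coe.2 (ENNReal.tsum_coe_ne_top_iff_summable.1 this)
  refine ⟨aestronglyMeasurable_of_tendsto_ae atTop
    (f := fun n a => ∑ i ∈ Finset.range n, F i a)
    (fun n => Finset.aestronglyMeasurable_fun_sum _ fun i _ => (hF_int i).1)
    (hsum.mono fun a ha => ha.hasSum.tendsto_sum_nat), ?_⟩
  exact (lintegral_mono fun a => enorm_tsum_le_tsum_enorm).trans_lt hlin.lt_top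

theorem norm_cpow_mul_exp {a : ℂ} {x t : ℝ} (ht : 0 < t) :
    ‖(t : ℂ) ^ (a - 1) * exp (-(x * t))‖ = t ^ (a.re - 1) * Real.exp (-(x * t)) := by
  rw [norm_mul, norm_cpow_eq_rpow_re_of_pos ht, Complex.norm_exp]
  simp

theorem integrableOn_rpow_mul_exp {a x : ℝ} (ha : 0 < a) (hx : 0 < x) :
    IntegrableOn (fun t : ℝ => t ^ (a - 1) * Real.exp (-(x * t))) (Ioi 0) := by
  have h := integrableOn_rpow_mul_exp_neg_mul_rpow (s := a - 1) (by linarith) one_pos hx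
  simpa only [Real.rpow_one, neg_mul] using h

theorem continuousOn_ofReal_cpow (a : ℂ) :
    ContinuousOn (fun t : ℝ => (t : ℂ) ^ a) (Ioi 0) := fun t ht =>
  (continuousAt_ofReal_cpow_const t a (Or.inr (mem_Ioi.1 ht).ne')).continuousWithinAt

theorem integrableOn_cpow_mul_exp {a : ℂ} (ha : 0 < a.re) {x : ℝ} (hx : 0 < x) :
    IntegrableOn (fun t : ℝ => (t : ℂ) ^ (a - 1) * exp (-(x * t))) (Ioi 0) := by
  refine Integrable.mono' (integrableOn_rpow_mul_exp ha hx) ?_ ?_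
  · refine ContinuousOn.aestronglyMeasurable ?_ measurableSet_Ioi
    exact (continuousOn_ofReal_cpow _).mul (by fun_prop)
  · filter_upwards [ae_restrict_mem measurableSet_Ioi] with t ht
    exact (norm_cpow_mul_exp ht).le

theorem ofReal_rpow_pow_mul_cpow {t : ℝ} (ht : 0 < t) (ς : ℝ) (a : ℂ) (k : ℕ) :
    (t : ℂ) ^ (a - 1) * ((t ^ ς : ℝ) : ℂ) ^ k = (t : ℂ) ^ (ς * k + a - 1) := by
  have ht' : (t : ℂ) ≠ 0 := ofReal_ne_zero.2 ht.ne'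
  rw [ofReal_cpow ht.le, ← cpow_mul_nat, ← cpow_add _ _ ht']
  congr 1
  ring

/-- Termwise Laplace transform of `t ^ (μ - 1) ∑ b_k t ^ (ς k)`, valid for large `x`. -/
theorem laplace_series {ς : ℝ} (hς : 0 < ς) {μ : ℂ} (hμ : 0 < μ.re) {b : ℕ → ℂ} {C K : ℝ}
    (hb : ∀ k : ℕ, ‖b k‖ * Real.Gamma (ς * k + μ.re) ≤ C * K ^ k) (hK : 0 < K) {x : ℝ}
    (hx : 0 < x) (hxK : K < x ^ ς) :
    IntegrableOn (fun t : ℝ => (t : ℂ) ^ (μ - 1) * (∑' k, b k * ((t ^ ς : ℝ) : ℂ) ^ k)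
      * exp (-(x * t))) (Ioi 0) ∧
    HasSum (fun k : ℕ => b k * ((1 / x : ℂ) ^ (ς * k + μ) * Gamma (ς * k + μ)))
      (∫ t in Ioi (0 : ℝ), (t : ℂ) ^ (μ - 1) * (∑' k, b k * ((t ^ ς : ℝ) : ℂ) ^ k)
        * exp (-(x * t))) := by
  set F : ℕ → ℝ → ℂ := fun k t => b k * ((t : ℂ) ^ (ς * k + μ - 1) * exp (-(x * t))) with hF
  have hre : ∀ k : ℕ, (ς * k + μ : ℂ).re = ς * k + μ.re := fun k => by simp
  have hpos : ∀ k : ℕ, 0 < ς * k + μ.re := fun k => by positivity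
  have hint : ∀ k, Integrable (F k) (volume.restrict (Ioi 0)) := fun k =>
    (integrableOn_cpow_mul_exp (by rw [hre]; exact hpos k) hx).const_mul _
  have hnorm : ∀ k, ∫ t in Ioi (0 : ℝ), ‖F k t‖
      = ‖b k‖ * ((1 / x) ^ (ς * k + μ.re) * Real.Gamma (ς * k + μ.re)) := by
    intro k
    rw [← Real.integral_rpow_mul_exp_neg_mul_Ioi (hpos k) hx, ← integral_const_mul]
    refine setIntegral_congr_fun measurableSet_Ioi fun t ht => ?_
    simp only [hF]
    rw [norm_mul, norm_cpow_mul_exp ht, hre]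
  have hsum : Summable fun k => ∫ t in Ioi (0 : ℝ), ‖F k t‖ := by
    simp_rw [hnorm]
    have hxς : 0 < x ^ ς := by positivity
    refine Summable.of_nonneg_of_le (f := fun k : ℕ => C * (1 / x) ^ μ.re * (K / x ^ ς) ^ k)
      (fun k => ?_) (fun k => ?_) ?_
    · have := Real.Gamma_pos_of_pos (hpos k)
      positivity
    · have e : (1 / x) ^ (ς * k + μ.re) = (1 / x ^ ς) ^ k * (1 / x) ^ μ.re := by
        rw [Real.rpow_add (by positivity), Real.rpow_mul (by positivity), Real.rpow_natCast,
          Real.div_rpow zero_le_one hx.le, Real.one_rpow]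
      calc _ = (‖b k‖ * Real.Gamma (ς * k + μ.re)) * (1 / x) ^ (ς * k + μ.re) := by ring
        _ ≤ C * K ^ k * (1 / x) ^ (ς * k + μ.re) :=
          mul_le_mul_of_nonneg_right (hb k) (by positivity)
        _ = _ := by
          rw [e, div_pow, div_pow, one_pow]
          ring
    · refine (summable_geometric_of_lt_one (by positivity) ?_).mul_left _
      rwa [div_lt_one hxς]
  have hcongr : ∀ t ∈ Ioi (0 : ℝ), ∑' k, F k t
      = (t : ℂ) ^ (μ - 1) * (∑' k, b k * ((t ^ ς : ℝ) : ℂ) ^ k) * exp (-(x * t)) := by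
    intro t ht
    rw [← tsum_mul_left, ← tsum_mul_right]
    refine tsum_congr fun k => ?_
    simp only [hF]
    rw [← ofReal_rpow_pow_mul_cpow ht]
    ring
  constructor
  · exact (integrableOn_congr_fun hcongr measurableSet_Ioi).1
      (integrable_tsum_of_summable_integral_norm hint hsum)
  · have h := hasSum_integral_of_summable_integral_norm hint hsum
    rw [setIntegral_congr_fun measurableSet_Ioi hcongr] at h
    convert! h using 2 with k
    simp only [hF]
    rw [integral_const_mul, integral_cpow_mul_exp_neg_mul_Ioi (by rw [hre]; exact hpos k) hx]

theorem intervalIntegrable_cpow_mul {ζ : ℂ} (hζ : 0 < ζ.re) {f : ℝ → ℂ} {R : ℝ} (hR : 0 ≤ R)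
    (hf : ContinuousOn f (Icc 0 R)) :
    IntervalIntegrable (fun t : ℝ => (t : ℂ) ^ (ζ - 1) * f t) volume 0 R := by
  refine (intervalIntegral.intervalIntegrable_cpow' (by simpa using hζ)).mul_continuousOn ?_
  rwa [uIcc_of_le hR]

/-- Termwise Mellin integral over `[0, R]` of a power series. -/
theorem integral_cpow_mul_series {ζ : ℂ} (hζ : 0 < ζ.re) {b : ℕ → ℂ} {R : ℝ} (hR : 0 < R)
    (hb : Summable fun k => ‖b k‖ * R ^ k) :
    ∫ t in (0 : ℝ)..R, (t : ℂ) ^ (ζ - 1) * ∑' k, b k * (t : ℂ) ^ k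
      = (R : ℂ) ^ ζ * ∑' k, b k / (ζ + k) * (R : ℂ) ^ k := by
  have hζk : ∀ k : ℕ, 0 < (ζ + k).re := fun k => by simp; positivity
  set F : ℕ → ℝ → ℂ := fun k t => b k * (t : ℂ) ^ (ζ + k - 1) with hF
  have hint : ∀ k, Integrable (F k) (volume.restrict (Ioc 0 R)) := fun k => by
    have h := intervalIntegral.intervalIntegrable_cpow' (a := 0) (b := R) (r := ζ + k - 1)
      (by simpa using hζk k)
    exact ((intervalIntegrable_iff_integrableOn_Ioc_of_le hR.le).1 h).const_mul _
  have hnorm : ∀ k, ∫ t in Ioc (0 : ℝ) R, ‖F k t‖ = ‖b k‖ * (R ^ (ζ.re + k) / (ζ.re + k)) := by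
    intro k
    have hk : 0 < ζ.re + k := by positivity
    have h := integral_rpow (a := 0) (b := R) (r := ζ.re + k - 1) (Or.inl (by linarith))
    rw [sub_add_cancel, Real.zero_rpow hk.ne', sub_zero] at h
    rw [← h, intervalIntegral.integral_of_le hR.le, ← integral_const_mul]
    refine setIntegral_congr_fun measurableSet_Ioc fun t ht => ?_
    simp only [hF]
    rw [norm_mul, norm_cpow_eq_rpow_re_of_pos ht.1]
    simp
  have hsum : Summable fun k => ∫ t in Ioc (0 : ℝ) R, ‖F k t‖ := by
    simp_rw [hnorm]
    refine Summable.of_nonneg_of_le (fun k => by positivity) (fun k => ?_)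
      (hb.mul_left (R ^ ζ.re / ζ.re))
    rw [Real.rpow_add hR, Real.rpow_natCast]
    have : R ^ ζ.re * R ^ k / (ζ.re + k) ≤ R ^ ζ.re * R ^ k / ζ.re :=
      div_le_div_of_nonneg_left (by positivity) hζ (by linarith [(Nat.cast_nonneg k : (0 : ℝ) ≤ k)])
    calc _ ≤ ‖b k‖ * (R ^ ζ.re * R ^ k / ζ.re) := mul_le_mul_of_nonneg_left this (norm_nonneg _)
      _ = _ := by ring
  have h := hasSum_integral_of_summable_integral_norm hint hsum
  rw [intervalIntegral.integral_of_le hR.le]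
  have hcongr : ∀ t ∈ Ioc (0 : ℝ) R,
      (t : ℂ) ^ (ζ - 1) * ∑' k, b k * (t : ℂ) ^ k = ∑' k, F k t := by
    intro t ht
    rw [← tsum_mul_left]
    refine tsum_congr fun k => ?_
    simp only [hF]
    rw [show ζ + k - 1 = (ζ - 1) + k by ring, cpow_add _ _ (ofReal_ne_zero.2 ht.1.ne'),
      cpow_natCast]
    ring
  rw [setIntegral_congr_fun measurableSet_Ioc hcongr, ← h.tsum_eq, ← tsum_mul_left]
  refine tsum_congr fun k => ?_
  have hne : ζ + k ≠ 0 := fun h0 => by have := hζk k; rw [h0] at this; simp at this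
  simp only [hF]
  rw [integral_const_mul, ← intervalIntegral.integral_of_le hR.le,
    integral_cpow (Or.inl (by simpa using hζk k)), sub_add_cancel, ofReal_zero, zero_cpow hne,
    sub_zero, cpow_add _ _ (ofReal_ne_zero.2 hR.ne'), cpow_natCast]
  ring

/-! ### The Mellin transform of a binomial power -/

theorem integrableOn_rpow_mul_one_add_rpow {σ ρ : ℝ} (hσ : 0 < σ) (hρ : σ < ρ) :
    IntegrableOn (fun y : ℝ => y ^ (σ - 1) * (1 + y) ^ (-ρ)) (Ioi 0) := by
  have hmeas : ContinuousOn (fun y : ℝ => y ^ (σ - 1) * (1 + y) ^ (-ρ)) (Ioi 0) := by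
    intro y hy
    have hy' := mem_Ioi.1 hy
    refine ContinuousAt.continuousWithinAt (ContinuousAt.mul ?_ ?_)
    · exact Real.continuousAt_rpow_const _ _ (Or.inl hy'.ne')
    · exact ContinuousAt.rpow_const (by fun_prop) (Or.inl (by positivity))
  rw [← Ioc_union_Ioi_eq_Ioi zero_le_one]
  refine IntegrableOn.union ?_ ?_
  · refine Integrable.mono' (g := fun y : ℝ => y ^ (σ - 1)) ?_
      ((hmeas.mono Ioc_subset_Ioi_self).aestronglyMeasurable measurableSet_Ioc) ?_
    · exact (intervalIntegrable_iff_integrableOn_Ioc_of_le zero_le_one).1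
        (intervalIntegral.intervalIntegrable_rpow' (by linarith))
    · filter_upwards [ae_restrict_mem measurableSet_Ioc] with y hy
      have hy0 := hy.1
      rw [Real.norm_eq_abs, abs_of_nonneg (by positivity)]
      exact mul_le_of_le_one_right (by positivity)
        (Real.rpow_le_one_of_one_le_of_nonpos (by linarith) (by linarith))
  · refine Integrable.mono' (g := fun y : ℝ => y ^ (σ - 1 - ρ))
      (integrableOn_Ioi_rpow_of_lt (by linarith) one_pos)
      ((hmeas.mono (Ioi_subset_Ioi zero_le_one)).aestronglyMeasurable measurableSet_Ioi) ?_
    filter_upwards [ae_restrict_mem measurableSet_Ioi] with y hy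
    have hy0 : 0 < y := lt_trans one_pos hy
    rw [Real.norm_eq_abs, abs_of_nonneg (by positivity), sub_eq_add_neg (σ - 1),
      Real.rpow_add hy0]
    refine mul_le_mul_of_nonneg_left ?_ (by positivity)
    exact Real.rpow_le_rpow_of_nonpos hy0 (by linarith) (by linarith)

theorem one_add_mul_mem_slitPlane {l : ℂ} (hl : l ∈ slitPlane) {y : ℝ} (hy : 0 ≤ y) :
    1 + l * y ∈ slitPlane := by
  rw [mem_slitPlane_iff] at hl ⊢
  simp only [add_re, one_re, mul_re, ofReal_re, ofReal_im, mul_zero, sub_zero, add_im, one_im,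
    mul_im, zero_add]
  rcases hl with h | h
  · left; positivity
  · rcases hy.eq_or_lt with rfl | hy
    · left; simp
    · right; simpa using ⟨h, hy.ne'⟩

/-- Uniformly for `l` near a point of the slit plane, `|1 + l y|` is comparable to `1 + y`: the
quotient is the modulus of a point of the segment from `1` to `l`, which avoids the origin. -/
theorem exists_ball_le_norm_one_add_mul {l₀ : ℂ} (hl₀ : l₀ ∈ slitPlane) :
    ∃ ε > 0, ∃ c > 0, ∀ l ∈ Metric.ball l₀ ε, l ∈ slitPlane ∧
      ∀ y : ℝ, 0 ≤ y → c * (1 + y) ≤ ‖1 + l * y‖ := by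
  obtain ⟨ε, hε, hball⟩ := Metric.nhds_basis_closedBall.mem_iff.1
    (isOpen_slitPlane.mem_nhds hl₀)
  have hcomp : IsCompact (Icc (0 : ℝ) 1 ×ˢ Metric.closedBall l₀ ε) :=
    isCompact_Icc.prod (isCompact_closedBall l₀ ε)
  obtain ⟨q, hq, hmin⟩ := hcomp.exists_isMinOn
    ⟨(0, l₀), ⟨by simp, Metric.mem_closedBall_self hε.le⟩⟩
    (f := fun q : ℝ × ℂ => ‖(1 - q.1 : ℂ) + q.1 * q.2‖) (by fun_prop)
  refine ⟨ε, hε, ‖(1 - q.1 : ℂ) + q.1 * q.2‖, ?_, fun l hl =>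
    ⟨hball (Metric.ball_subset_closedBall hl), fun y hy => ?_⟩⟩
  · have := starConvex_one_slitPlane (hball hq.2) (a := 1 - q.1) (b := q.1)
      (by linarith [hq.1.2]) hq.1.1 (by ring)
    rw [real_smul, real_smul, mul_one, ofReal_sub, ofReal_one] at this
    exact norm_pos_iff.2 (slitPlane_ne_zero this)
  · have hy1 : 0 < 1 + y := by linarith
    have h := hmin (a := (y / (1 + y), l))
      ⟨⟨by positivity, (div_le_one hy1).2 (by linarith)⟩, Metric.ball_subset_closedBall hl⟩
    simp only [mem_ofPred_eq] at h
    have e : 1 + l * y = ((1 + y : ℝ) : ℂ)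
        * ((1 - (y / (1 + y) : ℝ) : ℂ) + (y / (1 + y) : ℝ) * l) := by
      have : (1 + y : ℂ) ≠ 0 := by exact_mod_cast hy1.ne'
      push_cast
      field_simp
      ring
    rw [e, norm_mul, norm_real, Real.norm_eq_abs, abs_of_pos hy1, mul_comm]
    exact mul_le_mul_of_nonneg_left h hy1.le

theorem norm_one_add_mul_cpow_le {l a : ℂ} (ha : 0 ≤ a.re) {c y : ℝ} (hc : 0 < c) (hy : 0 ≤ y)
    (h : c * (1 + y) ≤ ‖1 + l * y‖) :
    ‖(1 + l * y) ^ (-a)‖ ≤ c ^ (-a.re) * Real.exp (Real.pi * |a.im|) * (1 + y) ^ (-a.re) := by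
  have hpos : 0 < c * (1 + y) := by positivity
  have hne : 1 + l * y ≠ 0 := norm_pos_iff.1 (lt_of_lt_of_le hpos h)
  rw [norm_cpow_of_ne_zero hne, neg_re, neg_im, div_eq_mul_inv, ← Real.exp_neg]
  have h1 : ‖1 + l * y‖ ^ (-a.re) ≤ (c * (1 + y)) ^ (-a.re) :=
    Real.rpow_le_rpow_of_nonpos hpos h (by linarith)
  have h2 : Real.exp (-((1 + l * y).arg * -a.im)) ≤ Real.exp (Real.pi * |a.im|) := by
    apply Real.exp_le_exp.2
    refine (le_abs_self _).trans ?_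
    rw [abs_neg, abs_mul, abs_neg]
    exact mul_le_mul_of_nonneg_right (abs_arg_le_pi _) (abs_nonneg _)
  refine (mul_le_mul h1 h2 (Real.exp_pos _).le (by positivity)).trans (le_of_eq ?_)
  rw [Real.mul_rpow hc.le (by positivity)]
  ring

theorem continuousOn_one_add_mul_cpow {l : ℂ} (hl : l ∈ slitPlane) (a : ℂ) :
    ContinuousOn (fun y : ℝ => (1 + l * y) ^ a) (Ici 0) := fun y hy =>
  ContinuousAt.continuousWithinAt
    (ContinuousAt.cpow (f := fun y : ℝ => 1 + l * (y : ℂ)) (by fun_prop) continuousAt_const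
      (one_add_mul_mem_slitPlane hl hy))

theorem integrableOn_cpow_mul_one_add_mul_cpow {l : ℂ} (hl : l ∈ slitPlane) {s a : ℂ}
    (hs : 0 < s.re) (ha : s.re < a.re) :
    IntegrableOn (fun y : ℝ => (y : ℂ) ^ (s - 1) * (1 + l * y) ^ (-a)) (Ioi 0) := by
  obtain ⟨ε, hε, c, hc, h⟩ := exists_ball_le_norm_one_add_mul hl
  refine Integrable.mono' ((integrableOn_rpow_mul_one_add_rpow hs ha).const_mul
    (c ^ (-a.re) * Real.exp (Real.pi * |a.im|))) ?_ ?_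
  · exact ((continuousOn_ofReal_cpow _).mul
      ((continuousOn_one_add_mul_cpow hl _).mono Ioi_subset_Ici_self)).aestronglyMeasurable
      measurableSet_Ioi
  · filter_upwards [ae_restrict_mem measurableSet_Ioi] with y hy
    have hy' := (mem_Ioi.1 hy).le
    rw [norm_mul, norm_cpow_eq_rpow_re_of_pos hy, sub_re, one_re]
    have := norm_one_add_mul_cpow_le (l := l) (a := a) (by linarith) hc hy'
      ((h l (Metric.mem_ball_self hε)).2 y hy')
    refine (mul_le_mul_of_nonneg_left this (by positivity)).trans (le_of_eq (by ring))

theorem mellin_one_add_mul_cpow_of_pos {l : ℝ} (hl : 0 < l) {s a : ℂ}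
    (hs : 0 < s.re) (ha : s.re < a.re) :
    ∫ y in Ioi (0 : ℝ), (y : ℂ) ^ (s - 1) * (1 + (l : ℂ) * y) ^ (-a)
      = Gamma s * Gamma (a - s) / Gamma a * (l : ℂ) ^ (-s) := by
  have hl' : (l : ℂ) ∈ slitPlane := ofReal_mem_slitPlane.2 hl
  have ha0 : 0 < a.re := hs.trans ha
  have hGa : Gamma a ≠ 0 := Gamma_ne_zero_of_re_pos ha0
  set G : ℝ → ℝ → ℂ := fun y v =>
    (y : ℂ) ^ (s - 1) * ((v : ℂ) ^ (a - 1) * exp (-((1 + l * y : ℝ) * v))) with hG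
  have hinner : ∀ y ∈ Ioi (0 : ℝ), ∫ v in Ioi (0 : ℝ), G y v
      = Gamma a * ((y : ℂ) ^ (s - 1) * (1 + (l : ℂ) * y) ^ (-a)) := by
    intro y hy
    have hy' := mem_Ioi.1 hy
    have hp : 0 < 1 + l * y := by positivity
    simp only [hG]
    rw [integral_const_mul, integral_cpow_mul_exp_neg_mul_Ioi ha0 hp, one_div, inv_cpow _ _ (by
      rw [arg_ofReal_of_nonneg hp.le]; exact Real.pi_pos.ne), ← cpow_neg]
    push_cast
    ring
  have hinner' : ∀ v ∈ Ioi (0 : ℝ), ∫ y in Ioi (0 : ℝ), G y v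
      = Gamma s * (l : ℂ) ^ (-s) * ((v : ℂ) ^ (a - s - 1) * exp (-((1 : ℝ) * v))) := by
    intro v hv
    have hv' := mem_Ioi.1 hv
    have hp : 0 < l * v := by positivity
    have e : ∀ y : ℝ, G y v = (v : ℂ) ^ (a - 1) * exp (-((1 : ℝ) * v))
        * ((y : ℂ) ^ (s - 1) * exp (-((l * v : ℝ) * y))) := by
      intro y
      simp only [hG]
      have : exp (-(((1 + l * y : ℝ) : ℂ) * v))
          = exp (-((1 : ℝ) * v)) * exp (-((l * v : ℝ) * y)) := by
        rw [← Complex.exp_add]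
        congr 1
        push_cast
        ring
      rw [this]
      ring
    simp_rw [e]
    rw [integral_const_mul, integral_cpow_mul_exp_neg_mul_Ioi hs hp, one_div, inv_cpow _ _ (by
      rw [arg_ofReal_of_nonneg hp.le]; exact Real.pi_pos.ne), ← cpow_neg, ofReal_mul,
      mul_cpow_ofReal_nonneg hl.le hv'.le, show a - s - 1 = (a - 1) + -s by ring,
      cpow_add _ _ (ofReal_ne_zero.2 hv'.ne')]
    ring
  have hint : Integrable (Function.uncurry G)
      ((volume.restrict (Ioi (0 : ℝ))).prod (volume.restrict (Ioi (0 : ℝ)))) := by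
    rw [integrable_prod_iff]
    · refine ⟨?_, ?_⟩
      · filter_upwards [ae_restrict_mem measurableSet_Ioi] with y hy
        have hy' := mem_Ioi.1 hy
        exact Integrable.const_mul
          (integrableOn_cpow_mul_exp ha0 (by positivity : 0 < 1 + l * y)) ((y : ℂ) ^ (s - 1))
      · have h := (integrableOn_cpow_mul_one_add_mul_cpow hl' (s := s) (a := (a.re : ℂ)) hs
          (by simpa using ha)).norm.const_mul (Real.Gamma a.re)
        refine (integrableOn_congr_fun (fun y hy => ?_) measurableSet_Ioi).1 h
        have hy' := mem_Ioi.1 hy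
        have hp : 0 < 1 + l * y := by positivity
        have e : (1 + (l : ℂ) * y) = ((1 + l * y : ℝ) : ℂ) := by push_cast; rfl
        simp only [Function.uncurry, hG]
        rw [norm_mul, e, norm_cpow_eq_rpow_re_of_pos hp, neg_re, ofReal_re]
        rw [setIntegral_congr_fun (g := fun v : ℝ => ‖(y : ℂ) ^ (s - 1)‖
          * (v ^ (a.re - 1) * Real.exp (-((1 + l * y) * v)))) measurableSet_Ioi
          (fun v hv => by
            beta_reduce
            rw [norm_mul, norm_cpow_mul_exp (x := 1 + l * y) hv])]
        rw [integral_const_mul, Real.integral_rpow_mul_exp_neg_mul_Ioi ha0 hp, one_div,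
          Real.inv_rpow hp.le, Real.rpow_neg hp.le]
        ring
    · refine Measurable.aestronglyMeasurable ?_
      simp only [Function.uncurry_def, hG]
      fun_prop
  have hswap := integral_integral_swap hint
  rw [setIntegral_congr_fun measurableSet_Ioi hinner,
    setIntegral_congr_fun measurableSet_Ioi hinner', integral_const_mul, integral_const_mul,
    integral_cpow_mul_exp_neg_mul_Ioi (by simpa using ha) one_pos] at hswap
  simp only [ofReal_one, one_div, inv_one, one_cpow, one_mul] at hswap
  field_simp
  rw [mul_comm, hswap]
  ring

/-- Beta integral on the half-line, for a complex scale `l` off the negative axis: both sides are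
analytic in `l` and agree for `l > 0`. -/
theorem mellin_one_add_mul_cpow {l : ℂ} (hl : l ∈ slitPlane) {s a : ℂ}
    (hs : 0 < s.re) (ha : s.re < a.re) :
    ∫ y in Ioi (0 : ℝ), (y : ℂ) ^ (s - 1) * (1 + l * y) ^ (-a)
      = Gamma s * Gamma (a - s) / Gamma a * l ^ (-s) := by
  have hleft : AnalyticOnNhd ℂ
      (fun l : ℂ => ∫ y in Ioi (0 : ℝ), (y : ℂ) ^ (s - 1) * (1 + l * y) ^ (-a)) slitPlane := by
    refine DifferentiableOn.analyticOnNhd (fun l₀ hl₀ => ?_) isOpen_slitPlane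
    obtain ⟨ε, hε, c, hc, h⟩ := exists_ball_le_norm_one_add_mul hl₀
    have ha1 : (-a - 1) = -(a + 1) := by ring
    have hcont : ∀ l ∈ slitPlane, ∀ a' s' : ℂ, AEStronglyMeasurable
        (fun y : ℝ => (y : ℂ) ^ s' * (1 + l * y) ^ a') (volume.restrict (Ioi 0)) :=
      fun l hl a' s' => ((continuousOn_ofReal_cpow _).mul
        ((continuousOn_one_add_mul_cpow hl _).mono Ioi_subset_Ici_self)).aestronglyMeasurable
        measurableSet_Ioi
    have hd := hasDerivAt_integral_of_dominated_loc_of_deriv_le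
      (μ := volume.restrict (Ioi (0 : ℝ)))
      (F := fun (l : ℂ) (y : ℝ) => (y : ℂ) ^ (s - 1) * (1 + l * y) ^ (-a))
      (F' := fun (l : ℂ) (y : ℝ) => -a * ((y : ℂ) ^ s * (1 + l * y) ^ (-(a + 1))))
      (bound := fun y => ‖a‖ * (c ^ (-(a + 1).re) * Real.exp (Real.pi * |(a + 1).im|)
        * (y ^ ((s.re + 1) - 1) * (1 + y) ^ (-(a.re + 1)))))
      (Metric.ball_mem_nhds l₀ hε) ?_ (integrableOn_cpow_mul_one_add_mul_cpow hl₀ hs ha)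
      ((hcont l₀ hl₀ _ _).const_mul _) ?_ ?_ ?_
    · exact hd.2.differentiableAt.differentiableWithinAt
    · filter_upwards [Metric.ball_mem_nhds l₀ hε] with l hl
      exact hcont l (h l hl).1 _ _
    · filter_upwards [ae_restrict_mem measurableSet_Ioi] with y hy l hl
      have hy' := (mem_Ioi.1 hy).le
      have h1 := norm_one_add_mul_cpow_le (l := l) (a := a + 1) (by simp; linarith) hc hy'
        ((h l hl).2 y hy')
      rw [norm_mul, norm_neg, norm_mul, norm_cpow_eq_rpow_re_of_pos hy, add_sub_cancel_right]
      refine mul_le_mul_of_nonneg_left ?_ (norm_nonneg _)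
      refine (mul_le_mul_of_nonneg_left h1 (by positivity)).trans (le_of_eq ?_)
      rw [add_re, one_re]
      ring
    · exact ((integrableOn_rpow_mul_one_add_rpow (by linarith) (by linarith)).const_mul
        _).const_mul _
    · filter_upwards [ae_restrict_mem measurableSet_Ioi] with y hy l hl
      have hy' := mem_Ioi.1 hy
      have h1 : HasDerivAt (fun l : ℂ => 1 + l * y) (y : ℂ) l := by
        simpa using ((hasDerivAt_id l).mul_const (y : ℂ)).const_add 1
      have h2 := (h1.cpow_const (c := -a)
        (one_add_mul_mem_slitPlane (h l hl).1 hy'.le)).const_mul ((y : ℂ) ^ (s - 1))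
      convert! h2 using 1
      rw [ha1, cpow_sub _ _ (ofReal_ne_zero.2 hy'.ne'), cpow_one]
      have : (y : ℂ) ≠ 0 := ofReal_ne_zero.2 hy'.ne'
      field_simp
  have hright : AnalyticOnNhd ℂ
      (fun l : ℂ => Gamma s * Gamma (a - s) / Gamma a * l ^ (-s)) slitPlane := by
    refine DifferentiableOn.analyticOnNhd (fun l₀ hl₀ => ?_) isOpen_slitPlane
    exact ((differentiableAt_id.cpow_const hl₀).const_mul _).differentiableWithinAt
  refine hleft.eqOn_of_preconnected_of_frequently_eq hright
    (starConvex_one_slitPlane.isPathConnected Complex.one_mem_slitPlane).isConnected.isPreconnected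
    Complex.one_mem_slitPlane ?_ hl
  -- the positive reals accumulate at `1`
  have ht : Tendsto (fun n : ℕ => ((1 + 1 / ((n : ℝ) + 1) : ℝ) : ℂ)) atTop (𝓝[≠] 1) := by
    refine tendsto_nhdsWithin_iff.2 ⟨?_, Eventually.of_forall fun n => ?_⟩
    · have h := (tendsto_one_div_add_atTop_nhds_zero_nat (𝕜 := ℝ)).const_add 1
      rw [add_zero] at h
      exact (continuous_ofReal.tendsto' 1 1 ofReal_one).comp h
    · have : (0 : ℝ) < 1 / ((n : ℝ) + 1) := by positivity
      rw [mem_compl_iff, mem_singleton_iff, ofReal_eq_one]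
      linarith
  refine ht.frequently (Eventually.frequently (Eventually.of_forall fun n => ?_))
  exact mellin_one_add_mul_cpow_of_pos (by positivity) hs ha

/-! ### The generating function of the Laplace-transformed coefficients -/

theorem choose_eq_rising_div_factorial (a : ℂ) (k : ℕ) :
    Ring.choose (a + k - 1) k = rising a k / k.factorial := by
  have h : ∀ n : ℕ, (ascPochhammer ℂ n).eval a = rising a n := by
    intro n
    induction n with
    | zero => simp
    | succ n ih => rw [ascPochhammer_succ_eval, ih, rising_succ]
  rw [Ring.choose_eq_smul, Polynomial.descPochhammer_smeval_eq_ascPochhammer,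
    Polynomial.ascPochhammer_smeval_cast, Polynomial.ascPochhammer_smeval_eq_eval,
    show a + k - 1 - k + 1 = a by ring, h, smul_eq_mul, div_eq_inv_mul]

theorem hasSum_rising_div_factorial (a : ℂ) {z : ℂ} (hz : ‖z‖ < 1) :
    HasSum (fun k : ℕ => rising a k / k.factorial * (-z) ^ k) ((1 + z) ^ (-a)) := by
  have h := (Complex.one_div_one_sub_cpow_hasFPowerSeriesOnBall_zero a).hasSum (y := -z) (by
    rw [← ENNReal.ofReal_one, Metric.eball_ofReal]
    simpa using hz)
  simp only [FormalMultilinearSeries.ofScalars_apply_eq, choose_eq_rising_div_factorial,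
    smul_eq_mul, zero_add, sub_neg_eq_add] at h
  rwa [one_div, ← cpow_neg] at h

/-- Every product of `m` linear factors in `s` is a combination of rising factorials of `δ + s`. -/
theorem exists_rising_eq_sum_rising (ς : ℝ) (τ δ : ℂ) (m : ℕ) :
    ∃ p : ℕ → ℂ, ∀ s : ℂ,
      rising (ς * s + τ) m = ∑ j ∈ Finset.range (m + 1), p j * rising (δ + s) j := by
  induction m with
  | zero => exact ⟨fun _ => 1, fun s => by simp⟩
  | succ m ih =>
    obtain ⟨p, hp⟩ := ih
    refine ⟨fun j => (if j = 0 then 0 else ς * p (j - 1))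
      + (if j = m + 1 then 0 else (τ + m - ς * δ - ς * j) * p j), fun s => ?_⟩
    rw [rising_succ, hp]
    simp only [add_mul, Finset.sum_add_distrib]
    rw [Finset.sum_range_succ' (fun j => (if j = 0 then 0 else ς * p (j - 1)) * rising (δ + s) j),
      Finset.sum_range_succ
      (fun j => (if j = m + 1 then 0 else (τ + m - ς * δ - ς * j) * p j) * rising (δ + s) j)]
    simp only [Nat.add_eq_zero_iff, one_ne_zero, and_false, if_false, if_true, zero_mul, add_zero,
      Nat.add_sub_cancel]
    rw [← Finset.sum_add_distrib, Finset.sum_mul]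
    refine Finset.sum_congr rfl fun j hj => ?_
    have hj' : j ≠ m + 1 := (Finset.mem_range.1 hj).ne
    rw [if_neg hj', rising_succ]
    ring

/-- The power series with coefficients `(δ)_k / k! · (ςk + τ)_m (-l) ^ k` continues analytically
along the positive axis to a combination of the powers `(1 + l y) ^ (-δ - j)`, because
`(δ)_k (δ + k)_j = (δ)_j (δ + j)_k`; its Mellin transform is then known. -/
theorem exists_generating_function (ς : ℝ) (τ : ℂ) {δ l : ℂ} (hδ : 0 < δ.re)
    (hl : l ∈ slitPlane) (m : ℕ) :
    ∃ h : ℂ → ℂ,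
      (∀ w : ℂ, ‖l * w‖ < 1 → HasSum (fun k : ℕ =>
        rising δ k / k.factorial * rising (ς * k + τ) m * (-(l * w)) ^ k) (h w)) ∧
      (∀ y : ℝ, 0 ≤ y → AnalyticAt ℂ h y) ∧
      ∀ s : ℂ, 0 < s.re → s.re < δ.re →
        IntegrableOn (fun y : ℝ => (y : ℂ) ^ (s - 1) * h y) (Ioi 0) ∧
        ∫ y in Ioi (0 : ℝ), (y : ℂ) ^ (s - 1) * h y
          = rising (τ - ς * s) m * (Gamma s * Gamma (δ - s) / Gamma δ) * l ^ (-s) := by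
  obtain ⟨p, hp⟩ := exists_rising_eq_sum_rising ς τ δ m
  refine ⟨fun w => ∑ j ∈ Finset.range (m + 1), p j * rising δ j * (1 + l * w) ^ (-(δ + j)),
    fun w hw => ?_, fun y hy => ?_, fun s hs hsδ => ?_⟩
  · have h : HasSum (fun k : ℕ => ∑ j ∈ Finset.range (m + 1), p j * rising δ j *
        (rising (δ + j) k / k.factorial * (-(l * w)) ^ k)) _ :=
      hasSum_sum fun j _ => (hasSum_rising_div_factorial (δ + j) hw).mul_left (p j * rising δ j)
    convert! h using 2 with k
    rw [hp, Finset.mul_sum, Finset.sum_mul]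
    refine Finset.sum_congr rfl fun j _ => ?_
    have e := (rising_add δ k j).symm.trans ((congrArg _ (add_comm k j)).trans (rising_add δ j k))
    linear_combination (p j * (-(l * w)) ^ k / k.factorial) * e
  · refine Finset.analyticAt_fun_sum _ fun j _ => ?_
    refine analyticAt_const.mul ?_
    exact (by fun_prop : AnalyticAt ℂ (fun w : ℂ => 1 + l * w) y).cpow analyticAt_const
      (one_add_mul_mem_slitPlane hl hy)
  · have hj : ∀ j : ℕ, s.re < (δ + j).re := fun j => by
      simp only [add_re, natCast_re]
      linarith [(Nat.cast_nonneg j : (0 : ℝ) ≤ j)]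
    have hint : ∀ j : ℕ, IntegrableOn (fun y : ℝ => p j * rising δ j *
        ((y : ℂ) ^ (s - 1) * (1 + l * y) ^ (-(δ + j)))) (Ioi 0) := fun j =>
      (integrableOn_cpow_mul_one_add_mul_cpow hl hs (hj j)).const_mul _
    have e : (fun y : ℝ => (y : ℂ) ^ (s - 1) * ∑ j ∈ Finset.range (m + 1),
        p j * rising δ j * (1 + l * y) ^ (-(δ + j)))
        = fun y : ℝ => ∑ j ∈ Finset.range (m + 1), p j * rising δ j *
          ((y : ℂ) ^ (s - 1) * (1 + l * y) ^ (-(δ + j))) := by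
      ext y
      rw [Finset.mul_sum]
      exact Finset.sum_congr rfl fun j _ => by ring
    simp only [e]
    refine ⟨integrable_finsetSum _ fun j _ => hint j, ?_⟩
    rw [integral_finsetSum _ fun j _ => hint j,
      show τ - ς * s = ς * (-s) + τ by ring, hp, Finset.sum_mul, Finset.sum_mul]
    refine Finset.sum_congr rfl fun j _ => ?_
    rw [integral_const_mul, mellin_one_add_mul_cpow hl hs (hj j),
      show δ + j - s = (δ - s) + j by ring, Gamma_add_nat (w := δ - s) (by simpa using hsδ),
      Gamma_add_nat hδ, ← sub_eq_add_neg]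
    have h1 : Gamma δ ≠ 0 := Gamma_ne_zero_of_re_pos hδ
    have h2 : rising δ j ≠ 0 := by
      intro h0
      have := Gamma_add_nat hδ j
      rw [h0, zero_mul] at this
      exact Gamma_ne_zero_of_re_pos (by simp; positivity) this
    field_simp

/-! ### Laplace transforms: analyticity and injectivity -/

open scoped FourierTransform

theorem differentiableOn_laplace {D : ℝ → ℂ} {x₀ : ℝ}
    (hD : ∀ x : ℝ, x₀ < x → IntegrableOn (fun v : ℝ => D v * exp (-(x * v))) (Ioi 0)) :
    DifferentiableOn ℂ (fun z : ℂ => ∫ v in Ioi (0 : ℝ), D v * exp (-(z * v)))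
      {z | x₀ < z.re} := by
  intro z₀ hz₀
  have hz₀' : x₀ < z₀.re := hz₀
  set ε := (z₀.re - x₀) / 3 with hε
  have hε0 : 0 < ε := by rw [hε]; linarith
  set x₁ := x₀ + ε with hx₁
  have h1 := hD x₁ (by linarith)
  have hmeas : ∀ (z : ℂ) (g : ℝ → ℂ), Continuous g → AEStronglyMeasurable
      (fun v : ℝ => g v * (D v * exp (-(z * v)))) (volume.restrict (Ioi 0)) := by
    intro z g hg
    have e : (fun v : ℝ => g v * (D v * exp (-(z * v))))
        = fun v : ℝ => (D v * exp (-(x₁ * v))) * (g v * exp (-((z - x₁) * v))) := by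
      ext v
      rw [show -(z * v) = -(x₁ * v) + -((z - x₁) * v) by ring, Complex.exp_add]
      ring
    rw [e]
    exact h1.aestronglyMeasurable.mul (by fun_prop)
  have hnorm : ∀ (z : ℂ) (v : ℝ), ‖D v * exp (-(z * v))‖
      = ‖D v * exp (-(x₁ * v))‖ * Real.exp (-((z.re - x₁) * v)) := by
    intro z v
    rw [norm_mul, norm_mul, Complex.norm_exp, Complex.norm_exp, mul_assoc, ← Real.exp_add]
    congr 2
    simp
    ring
  have hre : ∀ z ∈ Metric.ball z₀ ε, ε ≤ z.re - x₁ := by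
    intro z hz
    have h2 : |(z - z₀).re| < ε := (abs_re_le_norm _).trans_lt (by simpa [dist_eq] using hz)
    rw [sub_re, abs_lt] at h2
    have : z₀.re = x₀ + 3 * ε := by rw [hε]; ring
    linarith [h2.1]
  have hd := hasDerivAt_integral_of_dominated_loc_of_deriv_le
    (μ := volume.restrict (Ioi (0 : ℝ)))
    (F := fun (z : ℂ) (v : ℝ) => D v * exp (-(z * v)))
    (F' := fun (z : ℂ) (v : ℝ) => -(v : ℂ) * (D v * exp (-(z * v))))
    (bound := fun v => 1 / ε * ‖D v * exp (-(x₁ * v))‖)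
    (Metric.ball_mem_nhds z₀ hε0)
    (Eventually.of_forall fun z => by simpa using hmeas z (fun _ => 1) continuous_const) ?_
    (hmeas z₀ _ (by fun_prop)) ?_ (h1.norm.const_mul _) ?_
  · exact hd.2.differentiableAt.differentiableWithinAt
  · refine Integrable.mono' h1.norm (by simpa using hmeas z₀ (fun _ => 1) continuous_const) ?_
    filter_upwards [ae_restrict_mem measurableSet_Ioi] with v hv
    rw [hnorm z₀ v]
    have := hre z₀ (Metric.mem_ball_self hε0)
    have hv' := (mem_Ioi.1 hv).le
    exact mul_le_of_le_one_right (norm_nonneg _) (Real.exp_le_one_iff.2 (by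
      have : 0 ≤ (z₀.re - x₁) * v := mul_nonneg (by linarith) hv'
      linarith))
  · filter_upwards [ae_restrict_mem measurableSet_Ioi] with v hv z hz
    have hv' := (mem_Ioi.1 hv).le
    rw [norm_mul, norm_neg, norm_real, Real.norm_eq_abs, abs_of_nonneg hv', hnorm z v]
    have h3 : v * Real.exp (-((z.re - x₁) * v)) ≤ 1 / ε := by
      have h4 : ε * v ≤ (z.re - x₁) * v := mul_le_mul_of_nonneg_right (hre z hz) hv'
      have h5 : ε * v ≤ Real.exp ((z.re - x₁) * v) := by
        linarith [Real.add_one_le_exp ((z.re - x₁) * v)]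
      rw [Real.exp_neg, ← div_eq_mul_inv, div_le_div_iff₀ (Real.exp_pos _) hε0]
      linarith
    calc _ = v * Real.exp (-((z.re - x₁) * v)) * ‖D v * exp (-(x₁ * v))‖ := by ring
      _ ≤ _ := mul_le_mul_of_nonneg_right h3 (norm_nonneg _)
  · refine Eventually.of_forall fun v z _ => ?_
    have h2 : HasDerivAt (fun z : ℂ => -(z * v)) (-(v : ℂ)) z :=
      (hasDerivAt_mul_const (v : ℂ)).fun_neg
    convert! (h2.cexp.const_mul (D v)) using 1
    ring

/-- A continuous function whose Laplace transform vanishes for large real arguments is zero: the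
transform vanishes on a half-plane, hence so does a Fourier transform. -/
theorem eq_zero_of_laplace_eq_zero {D : ℝ → ℂ} {x₀ x₁ : ℝ} (hcont : ContinuousOn D (Ioi 0))
    (hD : ∀ x : ℝ, x₀ < x → IntegrableOn (fun v : ℝ => D v * exp (-(x * v))) (Ioi 0))
    (h0 : ∀ x : ℝ, x₁ < x → ∫ v in Ioi (0 : ℝ), D v * exp (-(x * v)) = 0) :
    ∀ v : ℝ, 0 < v → D v = 0 := by
  have hopen : IsOpen {z : ℂ | x₀ < z.re} := isOpen_lt continuous_const continuous_re
  have hzero : EqOn (fun z : ℂ => ∫ v in Ioi (0 : ℝ), D v * exp (-(z * v))) (fun _ => 0)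
      {z | x₀ < z.re} := by
    set x₂ := max x₀ x₁ + 1 with hx₂
    refine ((differentiableOn_laplace hD).analyticOnNhd hopen).eqOn_of_preconnected_of_frequently_eq
      analyticOnNhd_const (convex_halfSpace_re_gt x₀).isPreconnected (z₀ := (x₂ : ℂ)) ?_ ?_
    · have := le_max_left x₀ x₁
      simp only [mem_ofPred_eq, ofReal_re]
      linarith
    · have ht : Tendsto (fun n : ℕ => ((x₂ + 1 / ((n : ℝ) + 1) : ℝ) : ℂ)) atTop
          (𝓝[≠] (x₂ : ℂ)) := by
        refine tendsto_nhdsWithin_iff.2 ⟨?_, Eventually.of_forall fun n => ?_⟩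
        · have h := (tendsto_one_div_add_atTop_nhds_zero_nat (𝕜 := ℝ)).const_add x₂
          rw [add_zero] at h
          exact (continuous_ofReal.tendsto x₂).comp h
        · have : (0 : ℝ) < 1 / ((n : ℝ) + 1) := by positivity
          rw [mem_compl_iff, mem_singleton_iff, ofReal_inj]
          linarith
      refine ht.frequently (Eventually.frequently (Eventually.of_forall fun n => ?_))
      have : (0 : ℝ) < 1 / ((n : ℝ) + 1) := by positivity
      exact h0 _ (by linarith [le_max_right x₀ x₁])
  intro v hv
  set G : ℝ → ℂ := indicator (Ioi 0) fun v => D v * exp (-((x₀ + 1 : ℝ) * v)) with hG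
  have hGint : Integrable G := (integrable_indicator_iff measurableSet_Ioi).2 (hD _ (by linarith))
  have hF : 𝓕 G = 0 := by
    ext η
    rw [Real.fourier_eq']
    have hz := hzero (x := ((x₀ + 1 : ℝ) : ℂ) + (2 * Real.pi * η : ℝ) * I) (by
      simp)
    rw [Pi.zero_apply]
    refine Eq.trans ?_ hz
    beta_reduce
    rw [← integral_indicator measurableSet_Ioi]
    refine integral_congr_ae (Eventually.of_forall fun w => ?_)
    by_cases hw : w ∈ Ioi (0 : ℝ)
    · simp only [hG, indicator_of_mem hw, smul_eq_mul]
      rw [mul_left_comm, ← Complex.exp_add]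
      congr 2
      simp
      ring
    · simp [hG, indicator_of_notMem hw]
  have hGc : ContinuousAt G v := by
    have h1 : ContinuousAt (fun v : ℝ => D v * exp (-((x₀ + 1 : ℝ) * v))) v :=
      (hcont.continuousAt (Ioi_mem_nhds hv)).mul (by fun_prop)
    refine h1.congr ?_
    filter_upwards [Ioi_mem_nhds hv] with w hw
    rw [hG, indicator_of_mem hw]
  have hinv := hGint.fourierInv_fourier_eq (by rw [hF]; exact integrable_zero _ _ _) hGc
  rw [hF, hG, indicator_of_mem (mem_Ioi.2 hv), Real.fourierInv_eq'] at hinv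
  simpa using hinv.symm

/-! ### An Abelian theorem -/

theorem exists_norm_le_of_tendsto {F : ℝ → ℂ} {J : ℂ} (hF : ContinuousOn F (Ici 0))
    (hJ : Tendsto F atTop (𝓝 J)) : ∃ B : ℝ, ∀ r : ℝ, 0 ≤ r → ‖F r‖ ≤ B := by
  obtain ⟨R, hR⟩ := eventually_atTop.1
    (hJ.norm.eventually (gt_mem_nhds (lt_add_one ‖J‖)))
  obtain ⟨B, hB⟩ := (isCompact_Icc (a := (0 : ℝ)) (b := R)).exists_bound_of_continuousOn
    (hF.mono Icc_subset_Ici_self)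
  refine ⟨max B (‖J‖ + 1), fun r hr => ?_⟩
  rcases le_total r R with h | h
  · exact (hB r ⟨hr, h⟩).trans (le_max_left _ _)
  · exact (hR r h).le.trans (le_max_right _ _)

theorem continuousOn_comp_rpow {F : ℝ → ℂ} (hF : ContinuousOn F (Ici 0)) {ς : ℝ} (hς : 0 < ς) :
    ContinuousOn (fun v : ℝ => F (v ^ ς)) (Ici 0) :=
  hF.comp (Real.continuous_rpow_const hς.le).continuousOn fun _ hv =>
    Real.rpow_nonneg (mem_Ici.1 hv) ς

theorem integrableOn_laplace_of_bounded {F : ℝ → ℂ} {B : ℝ} (hF : ContinuousOn F (Ici 0))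
    (hB : ∀ r : ℝ, 0 ≤ r → ‖F r‖ ≤ B) {ς : ℝ} (hς : 0 < ς) {σ : ℂ} (hσ : 0 < σ.re) {x : ℝ}
    (hx : 0 < x) :
    IntegrableOn (fun v : ℝ => (v : ℂ) ^ (σ - 1) * F (v ^ ς) * exp (-(x * v))) (Ioi 0) := by
  have h := Integrable.mul_bdd (c := B) (integrableOn_cpow_mul_exp hσ hx)
    (((continuousOn_comp_rpow hF hς).mono Ioi_subset_Ici_self).aestronglyMeasurable
      measurableSet_Ioi) (by
      filter_upwards [ae_restrict_mem measurableSet_Ioi] with v hv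
      exact hB _ (Real.rpow_nonneg (mem_Ioi.1 hv).le ς))
  refine h.congr (Eventually.of_forall fun v => ?_)
  ring

/-- If `F` has the limit `J` at infinity, the normalized Laplace transform
`x ^ σ ∫ v ^ (σ - 1) F (v ^ ς) e ^ (-x v) dv` tends to `J Γ(σ)` as `x` tends to zero. -/
theorem tendsto_cpow_mul_laplace {F : ℝ → ℂ} {J : ℂ} (hF : ContinuousOn F (Ici 0))
    (hJ : Tendsto F atTop (𝓝 J)) {ς : ℝ} (hς : 0 < ς) {σ : ℂ} (hσ : 0 < σ.re) :
    Tendsto (fun x : ℝ => (x : ℂ) ^ σ *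
      ∫ v in Ioi (0 : ℝ), (v : ℂ) ^ (σ - 1) * F (v ^ ς) * exp (-(x * v)))
      (𝓝[>] 0) (𝓝 (J * Gamma σ)) := by
  obtain ⟨B, hB⟩ := exists_norm_le_of_tendsto hF hJ
  have hkernel := integrableOn_cpow_mul_exp hσ one_pos
  have hlim : Tendsto (fun x : ℝ => ∫ w in Ioi (0 : ℝ),
      (w : ℂ) ^ (σ - 1) * exp (-((1 : ℝ) * w)) * F ((w * x⁻¹) ^ ς)) (𝓝[>] 0)
      (𝓝 (∫ w in Ioi (0 : ℝ), (w : ℂ) ^ (σ - 1) * exp (-((1 : ℝ) * w)) * J)) := by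
    refine tendsto_integral_filter_of_dominated_convergence
      (fun w => ‖(w : ℂ) ^ (σ - 1) * exp (-((1 : ℝ) * w))‖ * B) ?_ ?_ (hkernel.norm.mul_const _) ?_
    · filter_upwards [self_mem_nhdsWithin] with x hx
      have hx' := mem_Ioi.1 hx
      refine hkernel.aestronglyMeasurable.mul (ContinuousOn.aestronglyMeasurable ?_
        measurableSet_Ioi)
      refine (continuousOn_comp_rpow hF hς).comp (by fun_prop) fun w hw => ?_
      have := mem_Ioi.1 hw
      exact mem_Ici.2 (by positivity)
    · filter_upwards [self_mem_nhdsWithin] with x hx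
      have hx' := mem_Ioi.1 hx
      filter_upwards [ae_restrict_mem measurableSet_Ioi] with w hw
      have := mem_Ioi.1 hw
      rw [norm_mul]
      exact mul_le_mul_of_nonneg_left (hB _ (by positivity)) (norm_nonneg _)
    · filter_upwards [ae_restrict_mem measurableSet_Ioi] with w hw
      refine Tendsto.const_mul _ (hJ.comp ((tendsto_rpow_atTop hς).comp ?_))
      exact tendsto_inv_nhdsGT_zero.const_mul_atTop (mem_Ioi.1 hw)
  rw [integral_mul_const, integral_cpow_mul_exp_neg_mul_Ioi hσ one_pos] at hlim
  simp only [ofReal_one, one_div, inv_one, one_cpow, one_mul] at hlim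
  rw [mul_comm]
  refine hlim.congr' ?_
  filter_upwards [self_mem_nhdsWithin] with x hx
  have hx' := mem_Ioi.1 hx
  have hxc : (x : ℂ) ≠ 0 := ofReal_ne_zero.2 hx'.ne'
  -- substitute `w = x v`
  have hsub := integral_comp_mul_left_Ioi
    (fun w : ℝ => (w : ℂ) ^ (σ - 1) * exp (-w) * F ((w * x⁻¹) ^ ς)) 0 hx'
  rw [mul_zero, real_smul, ofReal_inv] at hsub
  have hI : ∫ w in Ioi (0 : ℝ), (w : ℂ) ^ (σ - 1) * exp (-w) * F ((w * x⁻¹) ^ ς)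
      = x * ∫ v in Ioi (0 : ℝ), (((x * v : ℝ) : ℂ)) ^ (σ - 1) * exp (-((x * v : ℝ) : ℂ))
        * F ((x * v * x⁻¹) ^ ς) := by
    rw [hsub, mul_inv_cancel_left₀ hxc]
  rw [hI, ← integral_const_mul, ← integral_const_mul]
  refine setIntegral_congr_fun measurableSet_Ioi fun v hv => ?_
  have hv' := mem_Ioi.1 hv
  rw [show x * v * x⁻¹ = v by field_simp, ofReal_mul, mul_cpow_ofReal_nonneg hx'.le hv'.le, cpow_sub _ _ hxc,
    cpow_one]
  field_simp

theorem analyticAt_comp_ofReal {g : ℂ → ℂ} {x : ℝ} (hg : AnalyticAt ℂ g x) :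
    AnalyticAt ℝ (fun x : ℝ => g x) x :=
  AnalyticAt.fun_comp (g := g) (f := fun x : ℝ => (x : ℂ)) hg.restrictScalars
    (ofRealCLM.analyticAt x)

/-- The primitive of `y ^ (ζ - 1) h(y)` at `x ^ (-ς)` and an analytic function that agree for large
`x > 0` agree for all `x > 0`: their derivatives are real-analytic. -/
theorem eqOn_Ioi_of_eventually_eq {h A : ℂ → ℂ} (ς : ℝ) {ζ : ℂ} (hζ : 0 < ζ.re)
    (hh : ∀ y : ℝ, 0 ≤ y → AnalyticAt ℂ h y) (hA : ∀ x : ℝ, 0 < x → AnalyticAt ℂ A x) {x₁ : ℝ}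
    (hx₁ : 0 < x₁)
    (hAH : ∀ x : ℝ, x₁ < x → A x = ∫ y in (0 : ℝ)..x ^ (-ς), (y : ℂ) ^ (ζ - 1) * h y) {x : ℝ}
    (hx : 0 < x) : A x = ∫ y in (0 : ℝ)..x ^ (-ς), (y : ℂ) ^ (ζ - 1) * h y := by
  set H : ℝ → ℂ := fun x => ∫ y in (0 : ℝ)..x ^ (-ς), (y : ℂ) ^ (ζ - 1) * h y with hH
  set β : ℂ → ℂ := fun z => (-ς * z ^ (-ς - 1 : ℂ)) * ((z ^ (-ς : ℂ)) ^ (ζ - 1) * h (z ^ (-ς : ℂ)))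
    with hβ
  have hcast : ∀ x : ℝ, 0 < x → (x : ℂ) ^ (-ς : ℂ) = ((x ^ (-ς) : ℝ) : ℂ) := fun x hx => by
    rw [ofReal_cpow hx.le, ofReal_neg]
  have hβan : ∀ x : ℝ, 0 < x → AnalyticAt ℂ β x := by
    intro x hx
    have hsl : (x : ℂ) ∈ slitPlane := ofReal_mem_slitPlane.2 hx
    have h1 : ∀ a : ℂ, AnalyticAt ℂ (fun z : ℂ => z ^ a) x := fun a =>
      analyticAt_id.cpow analyticAt_const hsl
    have hy : 0 < x ^ (-ς) := Real.rpow_pos_of_pos hx _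
    refine (analyticAt_const.mul (h1 _)).mul (AnalyticAt.mul ?_ ?_)
    · exact (h1 _).cpow analyticAt_const (by
        rw [hcast x hx]
        exact ofReal_mem_slitPlane.2 hy)
    · refine AnalyticAt.fun_comp (g := h) (f := fun z : ℂ => z ^ (-ς : ℂ)) ?_ (h1 _)
      rw [hcast x hx]
      exact hh _ hy.le
  have hHd : ∀ x : ℝ, 0 < x → HasDerivAt H (β x) x := by
    intro x hx
    have hy : 0 < x ^ (-ς) := Real.rpow_pos_of_pos hx _
    have hc : ContinuousOn (fun y : ℝ => (y : ℂ) ^ (ζ - 1) * h y) (Ioi 0) :=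
      (continuousOn_ofReal_cpow _).mul fun y hy =>
        ((hh y (mem_Ioi.1 hy).le).continuousAt.comp
          continuous_ofReal.continuousAt).continuousWithinAt
    have h1 := intervalIntegral.integral_hasDerivAt_right
      (intervalIntegrable_cpow_mul hζ (f := fun y : ℝ => h y) hy.le fun y hy =>
        ((hh y hy.1).continuousAt.comp continuous_ofReal.continuousAt).continuousWithinAt)
      (hc.stronglyMeasurableAtFilter isOpen_Ioi _ hy)
      (hc.continuousAt (Ioi_mem_nhds hy))
    have h2 := HasDerivAt.scomp x h1 (Real.hasDerivAt_rpow_const (p := -ς) (Or.inl hx.ne'))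
    convert! h2 using 1
    simp only [hβ]
    rw [real_smul, hcast x hx, ofReal_mul, ofReal_neg, ofReal_cpow hx.le (-ς - 1), ofReal_sub,
      ofReal_neg, ofReal_one]
  have hAd : ∀ x : ℝ, 0 < x → HasDerivAt (fun x : ℝ => A x) (deriv A x) x := fun x hx =>
    (hA x hx).differentiableAt.hasDerivAt.comp_ofReal
  have hderiv : EqOn (fun x : ℝ => deriv A x) (fun x : ℝ => β x) (Ioi 0) := by
    have h1 : AnalyticOnNhd ℝ (fun x : ℝ => deriv A x) (Ioi 0) := fun x hx =>
      analyticAt_comp_ofReal (hA x hx).deriv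
    have h2 : AnalyticOnNhd ℝ (fun x : ℝ => β x) (Ioi 0) := fun x hx =>
      analyticAt_comp_ofReal (hβan x hx)
    refine h1.eqOn_of_preconnected_of_eventuallyEq h2 isPreconnected_Ioi (z₀ := x₁ + 1)
      (mem_Ioi.2 (by linarith)) ?_
    filter_upwards [Ioi_mem_nhds (lt_add_one x₁)] with x hx
    have hx' := mem_Ioi.1 hx
    have he : (fun x : ℝ => A x) =ᶠ[𝓝 x] H := by
      filter_upwards [Ioi_mem_nhds hx'] with y hy
      exact hAH y hy
    exact ((hAd x (by linarith)).congr_of_eventuallyEq he.symm).unique (hHd x (by linarith))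
  refine isOpen_Ioi.eqOn_of_deriv_eq (f := fun x : ℝ => A x) (g := H) isPreconnected_Ioi
    (fun x hx => (hAd x hx).differentiableAt.differentiableWithinAt)
    (fun x hx => (hHd x hx).differentiableAt.differentiableWithinAt) (fun x hx => ?_)
    (mem_Ioi.2 (by linarith : 0 < x₁ + 1)) (hAH _ (lt_add_one x₁)) (mem_Ioi.2 hx)
  rw [(hAd x hx).deriv, (hHd x hx).deriv]
  exact hderiv hx

/-! ### The value of the improper integral -/

/-- The Prabhakar function of a complex variable. -/
noncomputable def prabhakarC (ς : ℝ) (τ δ z : ℂ) : ℂ := ∑' k : ℕ, coeff ς τ δ k * z ^ k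

theorem prabhakarC_neg_mul (ς : ℝ) (τ δ l z : ℂ) :
    prabhakarC ς τ δ (-l * z) = ∑' k : ℕ, coeff ς τ δ k * (-l) ^ k * z ^ k := by
  simp only [prabhakarC, mul_pow, mul_assoc]

theorem continuous_prabhakarC {ς : ℝ} (hς : 0 < ς) (τ δ : ℂ) :
    Continuous (prabhakarC ς τ δ) := by
  refine continuous_iff_continuousAt.2 fun z => ?_
  have hc : ContinuousOn (prabhakarC ς τ δ) (Metric.ball 0 (‖z‖ + 1)) := by
    refine continuousOn_tsum (fun k => by fun_prop)
      (summable_norm_coeff_mul_pow hς τ δ (by positivity : 0 ≤ ‖z‖ + 1)) fun k w hw => ?_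
    rw [norm_mul, norm_pow]
    have : ‖w‖ < ‖z‖ + 1 := by simpa using hw
    exact mul_le_mul_of_nonneg_left (pow_le_pow_left₀ (norm_nonneg _) this.le k) (norm_nonneg _)
  exact hc.continuousAt (Metric.isOpen_ball.mem_nhds (by simp))

theorem intervalIntegrable_cpow_mul_prabhakarC {ς : ℝ} (hς : 0 < ς) (τ δ l : ℂ) {ζ : ℂ}
    (hζ : 0 < ζ.re) {R : ℝ} (hR : 0 ≤ R) :
    IntervalIntegrable (fun t : ℝ => (t : ℂ) ^ (ζ - 1) * prabhakarC ς τ δ (-l * t)) volume 0 R :=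
  intervalIntegrable_cpow_mul hζ hR
    ((continuous_prabhakarC hς τ δ).comp (by fun_prop)).continuousOn

theorem continuousOn_integral_prabhakarC {ς : ℝ} (hς : 0 < ς) (τ δ l : ℂ) {ζ : ℂ}
    (hζ : 0 < ζ.re) : ContinuousOn
      (fun R : ℝ => ∫ t in (0 : ℝ)..R, (t : ℂ) ^ (ζ - 1) * prabhakarC ς τ δ (-l * t)) (Ici 0) := by
  intro R hR
  have hR' : 0 ≤ R + 1 := by linarith [mem_Ici.1 hR]
  have h := intervalIntegral.continuousOn_primitive_interval'
    (intervalIntegrable_cpow_mul_prabhakarC hς τ δ l hζ hR') left_mem_uIcc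
  rw [uIcc_of_le hR'] at h
  refine (h R ⟨hR, by linarith⟩).mono_of_mem_nhdsWithin ?_
  rw [← Ici_inter_Iic]
  exact inter_mem_nhdsWithin _ (Iic_mem_nhds (by linarith))

theorem exists_norm_coeff_mul_pow_mul_Gamma_le {ς : ℝ} (hς : 0 < ς) (τ δ l : ℂ) {m : ℕ}
    (hm : 1 / 2 < τ.re + m) :
    ∃ C K : ℝ, 0 < C ∧ 0 < K ∧ ∀ k : ℕ,
      ‖coeff ς τ δ k * (-l) ^ k‖ * Real.Gamma (ς * k + (τ + m).re) ≤ C * K ^ k := by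
  obtain ⟨C, K, hC, hK, h⟩ := exists_norm_coeff_mul_Gamma_le hς τ δ hm
  refine ⟨C, K * (‖l‖ + 1), hC, by positivity, fun k => ?_⟩
  have hl : ‖l‖ ^ k ≤ (‖l‖ + 1) ^ k := pow_le_pow_left₀ (norm_nonneg _) (by linarith) k
  have hΓ : 0 < Real.Gamma (ς * k + (τ.re + m)) := Real.Gamma_pos_of_pos (by positivity)
  rw [norm_mul, norm_pow, norm_neg, add_re, natCast_re]
  calc _ = (‖coeff ς τ δ k‖ * Real.Gamma (ς * k + (τ.re + m))) * ‖l‖ ^ k := by ring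
    _ ≤ C * K ^ k * (‖l‖ + 1) ^ k :=
      mul_le_mul (h k) hl (by positivity) (by positivity)
    _ = _ := by rw [mul_pow]; ring

theorem coeff_mul_pow_mul_Gamma {ς : ℝ} (hς : 0 < ς) (τ δ l : ℂ) {m : ℕ}
    (hm : 0 < τ.re + m) (k : ℕ) :
    coeff ς τ δ k * (-l) ^ k * Gamma (ς * k + (τ + m))
      = rising δ k / k.factorial * rising (ς * k + τ) m * (-l) ^ k := by
  rw [← coeff_mul_Gamma hς τ δ hm]
  ring

theorem one_div_cpow_eq {x : ℝ} (hx : 0 < x) (ς : ℝ) (μ : ℂ) (k : ℕ) :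
    (1 / x : ℂ) ^ (ς * k + μ) = (x : ℂ) ^ (-μ) * ((x ^ (-ς) : ℝ) : ℂ) ^ k := by
  have hxc : (x : ℂ) ≠ 0 := ofReal_ne_zero.2 hx.ne'
  rw [one_div, inv_cpow _ _ (by rw [arg_ofReal_of_nonneg hx.le]; exact Real.pi_pos.ne), ← cpow_neg,
    neg_add_rev, cpow_add _ _ hxc, ofReal_cpow hx.le, ← cpow_mul_nat, ofReal_neg, neg_mul]

/-- Beyond some threshold in `x`, the point `x ^ (-ς)` lies in a given disc. -/
theorem exists_forall_rpow_lt {ς : ℝ} (hς : 0 < ς) (K r : ℝ) :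
    ∃ x₁ : ℝ, 0 < x₁ ∧ ∀ x : ℝ, x₁ < x → K < x ^ ς ∧ r * x ^ (-ς) < 1 := by
  have h1 : ∀ᶠ x : ℝ in atTop, max K r < x ^ ς :=
    (tendsto_rpow_atTop hς).eventually_gt_atTop _
  obtain ⟨x₁, hx₁⟩ := eventually_atTop.1 h1
  refine ⟨max x₁ 1, by positivity, fun x hx => ?_⟩
  have h2 := hx₁ x ((le_max_left _ _).trans hx.le)
  have hx0 : 0 < x := lt_of_lt_of_le one_pos ((le_max_right _ _).trans hx.le)
  refine ⟨(le_max_left _ _).trans_lt h2, ?_⟩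
  rw [Real.rpow_neg hx0.le, ← div_eq_mul_inv, div_lt_one (by positivity)]
  exact (le_max_right _ _).trans_lt h2

/-- For large `x`, the Laplace transform of `v ^ (μ - 1) E(-l v ^ ς)`, `μ = τ + m`, is
`x ^ (-μ) h(x ^ (-ς))`. -/
theorem exists_laplace_prabhakarC {ς : ℝ} (hς : 0 < ς) (τ δ l : ℂ) {m : ℕ}
    (hm : 1 / 2 < τ.re + m) {h : ℂ → ℂ}
    (hh : ∀ w : ℂ, ‖l * w‖ < 1 → HasSum (fun k : ℕ =>
        rising δ k / k.factorial * rising (ς * k + τ) m * (-(l * w)) ^ k) (h w)) :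
    ∃ x₁ : ℝ, 0 < x₁ ∧ ∀ x : ℝ, x₁ < x →
      IntegrableOn (fun v : ℝ => (v : ℂ) ^ (τ + m - 1) * prabhakarC ς τ δ (-l * (v ^ ς : ℝ))
        * exp (-(x * v))) (Ioi 0) ∧
      ∫ v in Ioi (0 : ℝ), (v : ℂ) ^ (τ + m - 1) * prabhakarC ς τ δ (-l * (v ^ ς : ℝ))
        * exp (-(x * v)) = (x : ℂ) ^ (-(τ + m)) * h ((x ^ (-ς) : ℝ) : ℂ) := by
  obtain ⟨C, K, hC, hK, hb⟩ := exists_norm_coeff_mul_pow_mul_Gamma_le hς τ δ l hm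
  obtain ⟨x₁, hx₁, hx₁'⟩ := exists_forall_rpow_lt hς K ‖l‖
  refine ⟨x₁, hx₁, fun x hx => ?_⟩
  have hx0 : 0 < x := hx₁.trans hx
  obtain ⟨hint, hsum⟩ := laplace_series hς (μ := τ + m) (by simp; linarith) hb hK hx0 (hx₁' x hx).1
  simp only [← prabhakarC_neg_mul] at hint hsum
  refine ⟨hint, hsum.unique ?_⟩
  have hw := (hh ((x ^ (-ς) : ℝ) : ℂ) (by
    rw [norm_mul, norm_real, Real.norm_eq_abs, abs_of_pos (by positivity)]
    exact (hx₁' x hx).2)).mul_left ((x : ℂ) ^ (-(τ + m)))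
  convert! hw using 2 with k
  rw [one_div_cpow_eq hx0, ← neg_mul, mul_pow, ← mul_assoc (_ / _ * _) ((-l) ^ k),
    ← coeff_mul_pow_mul_Gamma hς τ δ l (by linarith : 0 < τ.re + m)]
  ring

/-- The same for the primitive `F(R) = ∫_0^R t ^ (ζ - 1) E(-l t) dt`: its normalized Laplace
transform is, for large `x`, the primitive of `y ^ (ζ - 1) h(y)`. -/
theorem exists_laplace_integral_prabhakarC {ς : ℝ} (hς : 0 < ς) (τ δ l : ℂ) {ζ : ℂ}
    (hζ : 0 < ζ.re) {m : ℕ} (hm : 1 / 2 < τ.re + m) {h : ℂ → ℂ}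
    (hh : ∀ w : ℂ, ‖l * w‖ < 1 → HasSum (fun k : ℕ =>
        rising δ k / k.factorial * rising (ς * k + τ) m * (-(l * w)) ^ k) (h w)) :
    ∃ x₁ : ℝ, 0 < x₁ ∧ ∀ x : ℝ, x₁ < x →
      (x : ℂ) ^ (τ + m - ς * ζ) * ∫ v in Ioi (0 : ℝ), (v : ℂ) ^ (τ + m - ς * ζ - 1)
        * (∫ t in (0 : ℝ)..v ^ ς, (t : ℂ) ^ (ζ - 1) * prabhakarC ς τ δ (-l * t))
        * exp (-(x * v)) = ∫ y in (0 : ℝ)..x ^ (-ς), (y : ℂ) ^ (ζ - 1) * h y := by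
  obtain ⟨C, K, hC, hK, hb⟩ := exists_norm_coeff_mul_pow_mul_Gamma_le hς τ δ l hm
  obtain ⟨x₁, hx₁, hx₁'⟩ := exists_forall_rpow_lt hς K ‖l‖
  refine ⟨x₁, hx₁, fun x hx => ?_⟩
  have hx0 : 0 < x := hx₁.trans hx
  have hxc : (x : ℂ) ≠ 0 := ofReal_ne_zero.2 hx0.ne'
  have hy0 : 0 < x ^ (-ς) := by positivity
  have hb' : ∀ k : ℕ, ‖coeff ς τ δ k * (-l) ^ k / (ζ + k)‖ * Real.Gamma (ς * k + (τ + m).re)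
      ≤ C / ζ.re * K ^ k := by
    intro k
    have hk : ζ.re ≤ ‖ζ + k‖ := by
      refine le_trans ?_ (re_le_norm _)
      simp
    have hΓ : 0 < Real.Gamma (ς * k + (τ + m).re) := Real.Gamma_pos_of_pos (by
      simp only [add_re, natCast_re]
      positivity)
    rw [norm_div, div_mul_eq_mul_div, div_mul_eq_mul_div]
    exact div_le_div₀ (by positivity) (hb k) hζ hk
  obtain ⟨-, hsum⟩ := laplace_series hς (μ := τ + m) (by simp; linarith) hb' hK hx0 (hx₁' x hx).1
  -- termwise form of the inner integral
  have hF : ∀ v ∈ Ioi (0 : ℝ), (v : ℂ) ^ (τ + m - ς * ζ - 1)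
        * (∫ t in (0 : ℝ)..v ^ ς, (t : ℂ) ^ (ζ - 1) * prabhakarC ς τ δ (-l * t)) * exp (-(x * v))
      = (v : ℂ) ^ (τ + m - 1)
        * (∑' k : ℕ, coeff ς τ δ k * (-l) ^ k / (ζ + k) * ((v ^ ς : ℝ) : ℂ) ^ k)
        * exp (-(x * v)) := by
    intro v hv
    have hv' := mem_Ioi.1 hv
    simp only [prabhakarC_neg_mul]
    rw [integral_cpow_mul_series hζ (by positivity), ← mul_assoc]
    · rw [← cpow_mul_ofReal_nonneg hv'.le ς ζ, ← cpow_add _ _ (ofReal_ne_zero.2 hv'.ne')]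
      congr 3
      ring
    · refine (summable_norm_coeff_mul_pow hς τ δ
        (by positivity : 0 ≤ ‖l‖ * v ^ ς)).congr fun k => ?_
      rw [norm_mul, norm_pow, norm_neg, mul_pow]
      ring
  rw [setIntegral_congr_fun measurableSet_Ioi hF, ← hsum.tsum_eq]
  -- termwise form of the right-hand side
  have hc : ∀ y : ℝ, 0 ≤ y → y ≤ x ^ (-ς) → HasSum (fun k : ℕ =>
      rising δ k / k.factorial * rising (ς * k + τ) m * (-l) ^ k * (y : ℂ) ^ k) (h y) := by
    intro y hy hyx
    have := hh y (by
      rw [norm_mul, norm_real, Real.norm_eq_abs, abs_of_nonneg hy]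
      exact (mul_le_mul_of_nonneg_left hyx (norm_nonneg _)).trans_lt (hx₁' x hx).2)
    simpa only [← neg_mul, mul_pow, mul_assoc] using this
  have hR : ∫ y in (0 : ℝ)..x ^ (-ς), (y : ℂ) ^ (ζ - 1) * h y
      = ∫ y in (0 : ℝ)..x ^ (-ς), (y : ℂ) ^ (ζ - 1) * ∑' k : ℕ,
        rising δ k / k.factorial * rising (ς * k + τ) m * (-l) ^ k * (y : ℂ) ^ k := by
    refine intervalIntegral.integral_congr fun y hy => ?_
    rw [uIcc_of_le hy0.le] at hy
    rw [(hc y hy.1 hy.2).tsum_eq]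
  rw [hR, integral_cpow_mul_series hζ hy0, ← tsum_mul_left, ← tsum_mul_left]
  · refine tsum_congr fun k => ?_
    rw [one_div_cpow_eq hx0, ← coeff_mul_pow_mul_Gamma hς τ δ l (by linarith : 0 < τ.re + m)]
    have e : (((x ^ (-ς) : ℝ) : ℂ)) ^ ζ = (x : ℂ) ^ (τ + m - ς * ζ) * (x : ℂ) ^ (-(τ + m)) := by
      rw [← cpow_mul_ofReal_nonneg hx0.le (-ς) ζ, ← cpow_add _ _ hxc]
      congr 1
      push_cast
      ring
    rw [e]
    ring
  · have := (hc _ hy0.le le_rfl).summable.norm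
    refine this.congr fun k => ?_
    rw [norm_mul, norm_pow, norm_real, Real.norm_eq_abs, abs_of_pos hy0]

/-- The improper Mellin integral of the Prabhakar function has the expected value as soon as it
converges, even conditionally: both sides of the Laplace identity are compared as `x → 0`. -/
theorem value_of_tendsto {ς : ℝ} (hς : 0 < ς) {ζ l τ δ : ℂ} (hζ : 0 < ζ.re) (hζδ : ζ.re < δ.re)
    (hl : l ∈ slitPlane) {J : ℂ}
    (hJ : Tendsto (fun R : ℝ => ∫ t in (0 : ℝ)..R,
      (t : ℂ) ^ (ζ - 1) * prabhakarC ς τ δ (-l * t)) atTop (𝓝 J)) :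
    J = Gamma ζ * Gamma (δ - ζ) * (Gamma δ * Gamma (τ - ς * ζ))⁻¹ * l ^ (-ζ) := by
  -- `m` makes both `Re (τ + m) > 1 / 2` and `Re σ > 0`
  obtain ⟨m, hm⟩ := exists_nat_gt (1 / 2 + ς * ζ.re - τ.re)
  have hςζ : 0 < ς * ζ.re := by positivity
  obtain ⟨h, hh, hhan, hhmel⟩ :=
    exists_generating_function ς τ (hζ.trans hζδ) hl m
  set σ : ℂ := τ + m - ς * ζ with hσdef
  have hσ : 0 < σ.re := by
    simp [hσdef]
    linarith
  have hFc := continuousOn_integral_prabhakarC hς τ δ l hζ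
  obtain ⟨B, hB⟩ := exists_norm_le_of_tendsto hFc hJ
  set F : ℝ → ℂ := fun R => ∫ t in (0 : ℝ)..R, (t : ℂ) ^ (ζ - 1) * prabhakarC ς τ δ (-l * t)
    with hF
  obtain ⟨x₁, hx₁, hlarge⟩ := exists_laplace_integral_prabhakarC hς τ δ l hζ
    (m := m) (by linarith) hh
  set A : ℂ → ℂ := fun z => z ^ σ *
    ∫ v in Ioi (0 : ℝ), (v : ℂ) ^ (σ - 1) * F (v ^ ς) * exp (-(z * v)) with hA
  have hAan : ∀ x : ℝ, 0 < x → AnalyticAt ℂ A x := by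
    intro x hx
    have hopen : IsOpen {z : ℂ | 0 < z.re} := isOpen_lt continuous_const continuous_re
    refine (analyticAt_id.cpow analyticAt_const (ofReal_mem_slitPlane.2 hx)).mul ?_
    refine (differentiableOn_laplace (x₀ := 0) fun x hx => ?_).analyticAt
      (hopen.mem_nhds (by simpa using hx))
    exact integrableOn_laplace_of_bounded hFc hB hς hσ hx
  have hAH : ∀ x : ℝ, 0 < x → A x = ∫ y in (0 : ℝ)..x ^ (-ς), (y : ℂ) ^ (ζ - 1) * h y := fun x hx =>
    eqOn_Ioi_of_eventually_eq ς hζ hhan hAan hx₁ hlarge hx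
  obtain ⟨hint, hval⟩ := hhmel ζ hζ hζδ
  have hlim1 := tendsto_cpow_mul_laplace hFc hJ hς hσ
  have hlim2 := intervalIntegral_tendsto_integral_Ioi 0 hint
    (tendsto_rpow_neg_nhdsGT_zero (neg_lt_zero.2 hς))
  have hEq := tendsto_nhds_unique (hlim1.congr' (by
    filter_upwards [self_mem_nhdsWithin] with x hx
    exact hAH x hx)) hlim2
  rw [hval] at hEq
  have hΓσ : Gamma σ ≠ 0 := Gamma_ne_zero_of_re_pos hσ
  -- the shift `m` is undone here, also when `τ - ςζ` is a pole of `Γ`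
  have hinv := inv_Gamma_eq_rising_mul (τ - ς * ζ) m
  rw [show τ - ς * ζ + m = σ by rw [hσdef]; ring] at hinv
  rw [mul_inv, hinv, eq_div_of_mul_eq hΓσ hEq]
  field_simp

/-! ### Decay of the Prabhakar function in a sector -/

/-- The Mellin transform of `t ↦ E(-l t)`, as a function of `s`. -/
noncomputable def mellinSymbol (ς : ℝ) (τ δ l s : ℂ) : ℂ :=
  Gamma s * Gamma (δ - s) / Gamma δ * (Gamma (τ - ς * s))⁻¹ * l ^ (-s)

theorem continuous_mellinSymbol (ς : ℝ) (τ : ℂ) {δ l : ℂ} (hl : l ∈ slitPlane) {c : ℝ}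
    (hc : 0 < c) (hcδ : c < δ.re) :
    Continuous fun y : ℝ => mellinSymbol ς τ δ l (c + y * I) := by
  have hΓ : ∀ g : ℝ → ℂ, Continuous g → (∀ y, 0 < (g y).re) → Continuous fun y => Gamma (g y) := by
    refine fun g hg hpos => continuous_iff_continuousAt.2 fun y => ?_
    refine ContinuousAt.comp (f := g) (differentiableAt_Gamma _ fun n hn => ?_).continuousAt
      hg.continuousAt
    have := hpos y
    rw [hn, neg_re, natCast_re] at this
    linarith [(Nat.cast_nonneg n : (0 : ℝ) ≤ n)]
  refine (((hΓ _ (by fun_prop) fun y => ?_).mul (hΓ _ (by fun_prop) fun y => ?_)).div_const _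
    |>.mul ?_).mul ?_
  · simpa using hc
  · simpa using hcδ
  · exact differentiable_one_div_Gamma.continuous.comp
      (by fun_prop : Continuous fun y : ℝ => τ - ς * (c + y * I))
  · exact Continuous.const_cpow (by fun_prop) (Or.inl (slitPlane_ne_zero hl))

/-- On a vertical line, `Γ(s) Γ(δ - s)` decays like `e ^ (-π |y|)`, while `1 / Γ(τ - ςs)` and
`l ^ (-s)` grow at most like `e ^ (ς π |y| / 2)` and `e ^ (|arg l| |y|)`. -/
theorem exists_norm_mellinSymbol_le {ς : ℝ} (hς : 0 < ς) (τ : ℂ) {δ l : ℂ} (hl : l ∈ slitPlane)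
    (harg : |l.arg| < (1 - ς / 2) * Real.pi) {c : ℝ} (hc : 0 < c) (hcδ : c < δ.re) :
    ∃ C ε : ℝ, 0 < C ∧ 0 < ε ∧
      ∀ y : ℝ, ‖mellinSymbol ς τ δ l (c + y * I)‖ ≤ C * Real.exp (-(ε * |y|)) := by
  set gap := (1 - ς / 2) * Real.pi - |l.arg| with hgap
  have hgap0 : 0 < gap := by linarith
  have hpi := Real.pi_pos
  -- the three Gamma bounds together lose `(2 + ς) ε`, half of the gap
  set ε := gap / (2 * (2 + ς)) with hε
  have hε0 : 0 < ε := by positivity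
  have hε2 : (2 + ς) * ε = gap / 2 := by
    rw [hε]
    field_simp
  have hεpi : ε ≤ Real.pi / 2 := by
    have h1 : gap ≤ Real.pi := by
      rw [hgap]
      nlinarith [abs_nonneg l.arg]
    nlinarith
  obtain ⟨C₁, hC₁, h₁⟩ := exists_norm_Gamma_le hc hε0
  obtain ⟨C₂, hC₂, h₂⟩ := exists_norm_Gamma_le (x := δ.re - c) (by linarith) hε0
  obtain ⟨C₃, hC₃, h₃⟩ := exists_norm_inv_Gamma_le (τ.re - ς * c) hε0
  have hl0 : 0 < ‖l‖ := norm_pos_iff.2 (slitPlane_ne_zero hl)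
  have hΓδ : 0 < ‖Gamma δ‖ := norm_pos_iff.2 (Gamma_ne_zero_of_re_pos (hc.trans hcδ))
  refine ⟨C₁ * (C₂ * Real.exp ((Real.pi / 2 - ε) * |δ.im|)) / ‖Gamma δ‖
    * (C₃ * Real.exp ((Real.pi / 2 + ε) * |τ.im|)) * ‖l‖ ^ (-c), gap / 2, by positivity,
    by positivity, fun y => ?_⟩
  have e₂ : δ - (c + y * I) = ((δ.re - c : ℝ) : ℂ) + ((δ.im - y : ℝ) : ℂ) * I := by
    conv_lhs => rw [← re_add_im δ]
    push_cast
    ring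
  have e₃ : τ - ς * (c + y * I)
      = ((τ.re - ς * c : ℝ) : ℂ) + ((τ.im - ς * y : ℝ) : ℂ) * I := by
    conv_lhs => rw [← re_add_im τ]
    push_cast
    ring
  have b₂ : ‖Gamma (δ - (c + y * I))‖ ≤ C₂ * Real.exp ((Real.pi / 2 - ε) * |δ.im|)
      * Real.exp (-((Real.pi / 2 - ε) * |y|)) := by
    rw [e₂]
    refine (h₂ _).trans ?_
    rw [mul_assoc, ← Real.exp_add]
    refine mul_le_mul_of_nonneg_left (Real.exp_le_exp.2 ?_) hC₂.le
    have h4 : |y| - |δ.im| ≤ |δ.im - y| := by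
      rw [abs_sub_comm]
      exact abs_sub_abs_le_abs_sub _ _
    nlinarith
  have b₃ : ‖(Gamma (τ - ς * (c + y * I)))⁻¹‖ ≤ C₃ * Real.exp ((Real.pi / 2 + ε) * |τ.im|)
      * Real.exp ((Real.pi / 2 + ε) * (ς * |y|)) := by
    rw [e₃]
    refine (h₃ _).trans ?_
    rw [mul_assoc, ← Real.exp_add]
    refine mul_le_mul_of_nonneg_left (Real.exp_le_exp.2 ?_) hC₃.le
    have h4 : |τ.im - ς * y| ≤ |τ.im| + ς * |y| := by
      refine (abs_sub _ _).trans (le_of_eq ?_)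
      rw [abs_mul, abs_of_pos hς]
    nlinarith
  have b₄ : ‖l ^ (-(c + y * I : ℂ))‖ ≤ ‖l‖ ^ (-c) * Real.exp (|l.arg| * |y|) := by
    rw [norm_cpow_of_ne_zero (slitPlane_ne_zero hl), div_eq_mul_inv, ← Real.exp_neg]
    simp only [neg_re, add_re, ofReal_re, mul_re, I_re, mul_zero, ofReal_im, I_im, mul_one,
      sub_self, add_zero, neg_im, add_im, mul_im, zero_add]
    refine mul_le_mul_of_nonneg_left (Real.exp_le_exp.2 ?_) (by positivity)
    rw [mul_neg, neg_neg, ← abs_mul]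
    exact le_abs_self _
  rw [mellinSymbol, norm_mul, norm_mul, norm_div, norm_mul]
  have hexp : Real.exp (-((Real.pi / 2 - ε) * |y|)) * Real.exp (-((Real.pi / 2 - ε) * |y|))
      * Real.exp ((Real.pi / 2 + ε) * (ς * |y|)) * Real.exp (|l.arg| * |y|)
      = Real.exp (-(gap / 2 * |y|)) := by
    rw [← Real.exp_add, ← Real.exp_add, ← Real.exp_add]
    congr 1
    have : gap = (1 - ς / 2) * Real.pi - |l.arg| := hgap
    linear_combination |y| * hε2 - |y| * this
  calc _ ≤ C₁ * Real.exp (-((Real.pi / 2 - ε) * |y|))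
        * (C₂ * Real.exp ((Real.pi / 2 - ε) * |δ.im|) * Real.exp (-((Real.pi / 2 - ε) * |y|)))
        / ‖Gamma δ‖ * (C₃ * Real.exp ((Real.pi / 2 + ε) * |τ.im|)
          * Real.exp ((Real.pi / 2 + ε) * (ς * |y|)))
        * (‖l‖ ^ (-c) * Real.exp (|l.arg| * |y|)) := by
        gcongr
        exact h₁ y
    _ = C₁ * (C₂ * Real.exp ((Real.pi / 2 - ε) * |δ.im|)) / ‖Gamma δ‖
        * (C₃ * Real.exp ((Real.pi / 2 + ε) * |τ.im|)) * ‖l‖ ^ (-c)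
        * (Real.exp (-((Real.pi / 2 - ε) * |y|)) * Real.exp (-((Real.pi / 2 - ε) * |y|))
      * Real.exp ((Real.pi / 2 + ε) * (ς * |y|)) * Real.exp (|l.arg| * |y|)) := by ring
    _ = _ := by rw [hexp]

theorem integrable_exp_neg_mul_abs {ε : ℝ} (hε : 0 < ε) :
    Integrable fun y : ℝ => Real.exp (-(ε * |y|)) := by
  rw [← integrableOn_univ, ← Iic_union_Ioi (a := (0 : ℝ))]
  refine IntegrableOn.union ?_ ?_
  · refine (integrableOn_congr_fun (fun y hy => ?_) measurableSet_Iic).1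
      (integrableOn_exp_mul_Iic hε 0)
    rw [abs_of_nonpos (mem_Iic.1 hy), mul_neg, neg_neg]
  · refine (integrableOn_congr_fun (fun y hy => ?_) measurableSet_Ioi).1
      (exp_neg_integrableOn_Ioi 0 hε)
    rw [abs_of_pos (mem_Ioi.1 hy), neg_mul]

theorem integrable_mellinSymbol {ς : ℝ} (hς : 0 < ς) (τ : ℂ) {δ l : ℂ} (hl : l ∈ slitPlane)
    (harg : |l.arg| < (1 - ς / 2) * Real.pi) {c : ℝ} (hc : 0 < c) (hcδ : c < δ.re) :
    Integrable fun y : ℝ => mellinSymbol ς τ δ l (c + y * I) := by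
  obtain ⟨C, ε, hC, hε, h⟩ := exists_norm_mellinSymbol_le hς τ hl harg hc hcδ
  exact Integrable.mono' ((integrable_exp_neg_mul_abs hε).const_mul C)
    (continuous_mellinSymbol ς τ hl hc hcδ).aestronglyMeasurable (Eventually.of_forall h)

theorem norm_cpow_neg_line {t : ℝ} (ht : 0 < t) (c y : ℝ) :
    ‖(t : ℂ) ^ (-(c + y * I : ℂ))‖ = t ^ (-c) := by
  rw [norm_cpow_eq_rpow_re_of_pos ht]
  simp

theorem norm_mellinInv_le {M : ℂ → ℂ} (c : ℝ) {t : ℝ} (ht : 0 < t) :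
    ‖mellinInv c M t‖ ≤ 1 / (2 * Real.pi) * (∫ y : ℝ, ‖M (c + y * I)‖) * t ^ (-c) := by
  have hpi := Real.pi_pos
  rw [mellinInv, norm_smul, Real.norm_eq_abs, abs_of_pos (by positivity), mul_assoc]
  refine mul_le_mul_of_nonneg_left ?_ (by positivity)
  refine (norm_integral_le_integral_norm _).trans (le_of_eq ?_)
  rw [← integral_mul_const]
  refine integral_congr_ae (Eventually.of_forall fun y => ?_)
  simp only [smul_eq_mul, norm_mul, norm_cpow_neg_line ht]
  ring

theorem continuousOn_mellinInv {M : ℂ → ℂ} {c : ℝ}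
    (hM : Integrable fun y : ℝ => M (c + y * I)) : ContinuousOn (mellinInv c M) (Ioi 0) := by
  have e : ∀ t ∈ Ioi (0 : ℝ), mellinInv c M t = (1 / (2 * Real.pi)) • ((t : ℂ) ^ (-c : ℂ)
      * ∫ y : ℝ, (t : ℂ) ^ (-(y * I) : ℂ) * M (c + y * I)) := by
    intro t ht
    rw [mellinInv, ← integral_const_mul]
    congr 1
    refine integral_congr_ae (Eventually.of_forall fun y => ?_)
    simp only [smul_eq_mul]
    rw [neg_add, cpow_add _ _ (ofReal_ne_zero.2 (mem_Ioi.1 ht).ne'), mul_assoc]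
  refine ContinuousOn.congr ?_ e
  refine ContinuousOn.const_smul ((continuousOn_ofReal_cpow _).mul ?_) (1 / (2 * Real.pi))
  refine continuousOn_of_dominated (bound := fun y : ℝ => ‖M (c + y * I)‖) (fun t ht => ?_)
    (fun t ht => ?_) hM.norm ?_
  · refine AEStronglyMeasurable.mul (Continuous.aestronglyMeasurable ?_) hM.aestronglyMeasurable
    exact Continuous.const_cpow (by fun_prop) (Or.inl (ofReal_ne_zero.2 (mem_Ioi.1 ht).ne'))
  · refine Eventually.of_forall fun y => ?_
    rw [norm_mul, norm_cpow_eq_rpow_re_of_pos (mem_Ioi.1 ht)]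
    simp
  · exact Eventually.of_forall fun y => (continuousOn_ofReal_cpow _).mul continuousOn_const

/-- Multiplying the symbol by the Gamma factor of a Laplace transform removes `1 / Γ(τ - ςs)`. -/
theorem mellinSymbol_mul_Gamma (ς : ℝ) (τ δ l s : ℂ) {m : ℕ} (hs : 0 < (τ + m - ς * s).re) :
    mellinSymbol ς τ δ l s * Gamma (τ + m - ς * s)
      = rising (τ - ς * s) m * (Gamma s * Gamma (δ - s) / Gamma δ) * l ^ (-s) := by
  have h := inv_Gamma_eq_rising_mul (τ - ς * s) m
  rw [show τ - ς * s + m = τ + m - ς * s by ring] at h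
  have hne : Gamma (τ + m - ς * s) ≠ 0 := Gamma_ne_zero_of_re_pos hs
  rw [mellinSymbol, h]
  generalize Gamma (τ + m - ς * s) = G at hne
  field_simp

theorem re_laplace_exponent (ς c y : ℝ) (τ : ℂ) (m : ℕ) :
    (τ + m - ς * (c + y * I)).re = τ.re + m - ς * c := by
  simp

/-- The Laplace transform of the inverse Mellin transform of the symbol is the same function as for
the Prabhakar function, by Fubini and Mellin inversion for `h`. -/
theorem laplace_mellinInv {ς : ℝ} (hς : 0 < ς) (τ : ℂ) {δ l : ℂ} (hl : l ∈ slitPlane)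
    (harg : |l.arg| < (1 - ς / 2) * Real.pi) {c : ℝ} (hc : 0 < c) (hcδ : c < δ.re) {m : ℕ}
    (hm : 0 < τ.re + m - ς * c) {h : ℂ → ℂ} (hhan : ∀ y : ℝ, 0 ≤ y → AnalyticAt ℂ h y)
    (hhmel : ∀ s : ℂ, 0 < s.re → s.re < δ.re →
        IntegrableOn (fun y : ℝ => (y : ℂ) ^ (s - 1) * h y) (Ioi 0) ∧
        ∫ y in Ioi (0 : ℝ), (y : ℂ) ^ (s - 1) * h y
          = rising (τ - ς * s) m * (Gamma s * Gamma (δ - s) / Gamma δ) * l ^ (-s))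
    {x : ℝ} (hx : 0 < x) :
    IntegrableOn (fun v : ℝ => (v : ℂ) ^ (τ + m - 1) * mellinInv c (mellinSymbol ς τ δ l) (v ^ ς)
      * exp (-(x * v))) (Ioi 0) ∧
    ∫ v in Ioi (0 : ℝ), (v : ℂ) ^ (τ + m - 1) * mellinInv c (mellinSymbol ς τ δ l) (v ^ ς)
      * exp (-(x * v)) = (x : ℂ) ^ (-(τ + m)) * h ((x ^ (-ς) : ℝ) : ℂ) := by
  set M := mellinSymbol ς τ δ l with hMdef
  have hMc : Continuous fun y : ℝ => M (c + y * I) := continuous_mellinSymbol ς τ hl hc hcδ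
  have hMint : Integrable fun y : ℝ => M (c + y * I) :=
    integrable_mellinSymbol hς τ hl harg hc hcδ
  have hxc : (x : ℂ) ≠ 0 := ofReal_ne_zero.2 hx.ne'
  set G : ℝ → ℝ → ℂ := fun v y =>
    M (c + y * I) * ((v : ℂ) ^ (τ + m - ς * (c + y * I) - 1) * exp (-(x * v))) with hG
  have hGint : Integrable (Function.uncurry G)
      ((volume.restrict (Ioi (0 : ℝ))).prod volume) := by
    refine Integrable.mono' ((integrableOn_rpow_mul_exp hm hx).mul_prod hMint.norm) ?_ ?_
    · refine Measurable.aestronglyMeasurable ?_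
      simp only [Function.uncurry_def, hG]
      have := hMc.measurable.comp (measurable_snd : Measurable (Prod.snd : ℝ × ℝ → ℝ))
      exact this.mul (by fun_prop)
    · have hz : ∀ᵐ z : ℝ × ℝ ∂((volume.restrict (Ioi (0 : ℝ))).prod volume), z.1 ∈ Ioi (0 : ℝ) :=
        Measure.quasiMeasurePreserving_fst.ae (ae_restrict_mem measurableSet_Ioi)
      filter_upwards [hz] with z hz
      simp only [Function.uncurry_def, hG]
      rw [norm_mul, norm_cpow_mul_exp hz, re_laplace_exponent, mul_comm]
  have hv : ∀ v ∈ Ioi (0 : ℝ), (1 / (2 * Real.pi)) • ∫ y : ℝ, G v y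
      = (v : ℂ) ^ (τ + m - 1) * mellinInv c M (v ^ ς) * exp (-(x * v)) := by
    intro v hv
    have hv' := mem_Ioi.1 hv
    rw [mellinInv, mul_smul_comm, smul_mul_assoc, ← integral_const_mul, ← integral_mul_const]
    congr 1
    refine integral_congr_ae (Eventually.of_forall fun y => ?_)
    simp only [hG, smul_eq_mul]
    rw [← cpow_mul_ofReal_nonneg hv'.le, show τ + m - ς * (c + y * I) - 1
      = (τ + m - 1) + ς * -(c + y * I) by ring, cpow_add _ _ (ofReal_ne_zero.2 hv'.ne')]
    ring
  have hy : ∀ y : ℝ, ∫ v in Ioi (0 : ℝ), G v y = (x : ℂ) ^ (-(τ + m))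
      * (((x ^ (-ς) : ℝ) : ℂ) ^ (-(c + y * I)) * mellin (fun t : ℝ => h t) (c + y * I)) := by
    intro y
    have hs : 0 < (τ + m - ς * (c + y * I)).re := by rwa [re_laplace_exponent]
    have hmel := (hhmel (c + y * I) (by simpa using hc) (by simpa using hcδ)).2
    simp only [mellin, smul_eq_mul]
    rw [hmel, ← mellinSymbol_mul_Gamma ς τ δ l _ hs]
    simp only [hG]
    rw [integral_const_mul, integral_cpow_mul_exp_neg_mul_Ioi hs hx, one_div, inv_cpow _ _ (by
      rw [arg_ofReal_of_nonneg hx.le]; exact Real.pi_pos.ne), ← cpow_neg,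
      ← cpow_mul_ofReal_nonneg hx.le, show -(τ + m - ς * (c + y * I))
        = -(τ + m) + ((-ς : ℝ) : ℂ) * -(c + y * I) by push_cast; ring, cpow_add _ _ hxc]
    ring
  have hvert : VerticalIntegrable (mellin fun t : ℝ => h t) c := by
    refine Integrable.mono' (hMint.norm.mul_const (Real.Gamma (τ.re + m - ς * c))) ?_ ?_
    · have hcont : Continuous fun y : ℝ => M (c + y * I) * Gamma (τ + m - ς * (c + y * I)) := by
        refine hMc.mul (continuous_iff_continuousAt.2 fun y => ?_)
        refine ContinuousAt.comp (f := fun y : ℝ => τ + m - ς * (c + y * I))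
          (differentiableAt_Gamma _ fun n hn => ?_).continuousAt (by fun_prop)
        have := congrArg Complex.re hn
        rw [re_laplace_exponent, neg_re, natCast_re] at this
        linarith [(Nat.cast_nonneg n : (0 : ℝ) ≤ n)]
      refine hcont.aestronglyMeasurable.congr (Eventually.of_forall fun y => ?_)
      have hs : 0 < (τ + m - ς * (c + y * I)).re := by rwa [re_laplace_exponent]
      simp only [mellin, smul_eq_mul, hMdef]
      rw [(hhmel (c + y * I) (by simpa using hc) (by simpa using hcδ)).2,
        mellinSymbol_mul_Gamma ς τ δ l _ hs]
    · refine Eventually.of_forall fun y => ?_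
      have hs : 0 < (τ + m - ς * (c + y * I)).re := by rwa [re_laplace_exponent]
      simp only [mellin, smul_eq_mul]
      rw [(hhmel (c + y * I) (by simpa using hc) (by simpa using hcδ)).2,
        ← mellinSymbol_mul_Gamma ς τ δ l _ hs, norm_mul]
      refine mul_le_mul_of_nonneg_left ?_ (norm_nonneg _)
      have := norm_Gamma_le_Gamma_re hm (τ + m - ς * (c + y * I)).im
      rwa [← re_laplace_exponent ς c y, re_add_im, re_laplace_exponent] at this
  have hxς : 0 < x ^ (-ς) := by positivity
  have hinv := mellinInv_mellin_eq c (fun t : ℝ => h t) hxς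
    (hhmel c (by simpa using hc) (by simpa using hcδ)).1 hvert
    ((hhan _ hxς.le).continuousAt.comp continuous_ofReal.continuousAt)
  constructor
  · exact (integrableOn_congr_fun hv measurableSet_Ioi).1
      (hGint.integral_prod_left.smul (1 / (2 * Real.pi)))
  · rw [← setIntegral_congr_fun measurableSet_Ioi hv, integral_smul, integral_integral_swap hGint,
      ← hinv, mellinInv, mul_smul_comm, ← integral_const_mul]
    simp only [hy, smul_eq_mul]

/-- In the sector, `E(-l t)` is the inverse Mellin transform of its symbol on any line
`Re s = c` with `0 < c < Re δ`. -/
theorem prabhakarC_eq_mellinInv {ς : ℝ} (hς : 0 < ς) (τ : ℂ) {δ l : ℂ} (hl : l ∈ slitPlane)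
    (harg : |l.arg| < (1 - ς / 2) * Real.pi) {c : ℝ} (hc : 0 < c) (hcδ : c < δ.re) {t : ℝ}
    (ht : 0 < t) :
    prabhakarC ς τ δ (-l * t) = mellinInv c (mellinSymbol ς τ δ l) t := by
  -- `m` makes both Laplace integrals converge at the origin
  obtain ⟨m, hm⟩ := exists_nat_gt (1 / 2 + ς * c - τ.re)
  have hςc : 0 < ς * c := by positivity
  obtain ⟨h, hh, hhan, hhmel⟩ := exists_generating_function ς τ (hc.trans hcδ) hl m
  obtain ⟨x₁, hx₁, hlap⟩ := exists_laplace_prabhakarC hς τ δ l (m := m) (by linarith) hh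
  have hlap' := fun {x : ℝ} (hx : 0 < x) => laplace_mellinInv hς τ hl harg hc hcδ
    (m := m) (by linarith) hhan hhmel hx
  set g := mellinInv c (mellinSymbol ς τ δ l) with hg
  set D : ℝ → ℂ := fun v =>
    (v : ℂ) ^ (τ + m - 1) * (prabhakarC ς τ δ (-l * (v ^ ς : ℝ)) - g (v ^ ς)) with hD
  have hpow : ContinuousOn (fun v : ℝ => v ^ ς) (Ioi 0) :=
    (Real.continuous_rpow_const hς.le).continuousOn
  have hDc : ContinuousOn D (Ioi 0) := by
    refine (continuousOn_ofReal_cpow _).mul (ContinuousOn.sub ?_ ?_)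
    · have h1 : Continuous fun r : ℝ => prabhakarC ς τ δ (-l * r) :=
        (continuous_prabhakarC hς τ δ).comp (by fun_prop)
      exact h1.comp_continuousOn hpow
    · exact (continuousOn_mellinInv (integrable_mellinSymbol hς τ hl harg hc hcδ)).comp hpow
        fun v hv => Real.rpow_pos_of_pos (mem_Ioi.1 hv) ς
  have hDe : ∀ x : ℝ, (fun v : ℝ => D v * exp (-(x * v))) = fun v : ℝ =>
      (v : ℂ) ^ (τ + m - 1) * prabhakarC ς τ δ (-l * (v ^ ς : ℝ)) * exp (-(x * v))
      - (v : ℂ) ^ (τ + m - 1) * g (v ^ ς) * exp (-(x * v)) := by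
    intro x
    ext v
    simp only [hD]
    ring
  have hzero := eq_zero_of_laplace_eq_zero hDc (x₀ := x₁) (x₁ := x₁)
    (fun x hx => by
      rw [hDe]
      exact (hlap x hx).1.sub (hlap' (hx₁.trans hx)).1)
    (fun x hx => by
      rw [hDe, integral_sub (hlap x hx).1 (hlap' (hx₁.trans hx)).1, (hlap x hx).2,
        (hlap' (hx₁.trans hx)).2, sub_self])
  have hv : 0 < t ^ (1 / ς) := by positivity
  have h0 := hzero _ hv
  simp only [hD] at h0
  rw [← Real.rpow_mul ht.le, one_div_mul_cancel hς.ne', Real.rpow_one] at h0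
  exact sub_eq_zero.1 ((mul_eq_zero.1 h0).resolve_left
    (cpow_ne_zero_iff.2 (Or.inl (ofReal_ne_zero.2 hv.ne'))))

theorem integrableOn_cpow_mul_prabhakarC {ς : ℝ} (hς : 0 < ς) (τ : ℂ) {ζ δ l : ℂ}
    (hζ : 0 < ζ.re) (hζδ : ζ.re < δ.re) (hl : l ∈ slitPlane)
    (harg : |l.arg| < (1 - ς / 2) * Real.pi) :
    IntegrableOn (fun t : ℝ => (t : ℂ) ^ (ζ - 1) * prabhakarC ς τ δ (-l * t)) (Ioi 0) := by
  -- a line between `Re ζ` and `Re δ` gives a bound `t ^ (-c)` that is integrable at infinity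
  obtain ⟨c, hζc, hcδ⟩ := exists_between hζδ
  have hc : 0 < c := hζ.trans hζc
  rw [← Ioc_union_Ioi_eq_Ioi zero_le_one]
  refine IntegrableOn.union ((intervalIntegrable_iff_integrableOn_Ioc_of_le zero_le_one).1
    (intervalIntegrable_cpow_mul_prabhakarC hς τ δ l hζ zero_le_one)) ?_
  set C := 1 / (2 * Real.pi) * ∫ y : ℝ, ‖mellinSymbol ς τ δ l (c + y * I)‖ with hC
  refine Integrable.mono' (g := fun t : ℝ => C * t ^ (ζ.re - 1 - c))
    ((integrableOn_Ioi_rpow_of_lt (by linarith) one_pos).const_mul C) ?_ ?_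
  · refine ContinuousOn.aestronglyMeasurable ?_ measurableSet_Ioi
    exact ((continuousOn_ofReal_cpow _).mono (Ioi_subset_Ioi zero_le_one)).mul
      ((continuous_prabhakarC hς τ δ).comp (by fun_prop)).continuousOn
  · filter_upwards [ae_restrict_mem measurableSet_Ioi] with t ht
    have ht' : 0 < t := lt_trans one_pos ht
    rw [norm_mul, norm_cpow_eq_rpow_re_of_pos ht', prabhakarC_eq_mellinInv hς τ hl harg hc hcδ ht',
      sub_eq_add_neg (ζ.re - 1), Real.rpow_add ht', sub_re, one_re]
    refine (mul_le_mul_of_nonneg_left (norm_mellinInv_le c ht') (by positivity)).trans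
      (le_of_eq ?_)
    rw [hC]
    ring

/-! ### Reduction to the idempotent components -/

open Bicomplex

instance : FiniteDimensional ℝ Bicomplex :=
  FiniteDimensional.of_injective toEuclidean toEuclidean_injective

instance : CompleteSpace Bicomplex := FiniteDimensional.complete ℝ Bicomplex

/-- The first idempotent component as a ring homomorphism. -/
noncomputable def proj₁ : Bicomplex →+* ℂ where
  toFun := P₁
  map_zero' := by simp [P₁]
  map_one' := by simp [P₁]
  map_add' z w := by simp only [P₁, w₁_add, w₂_add]; ring
  map_mul' z w := by
    simp only [P₁, w₁_mul, w₂_mul]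
    linear_combination (-(z.w₂ * w.w₂)) * I_mul_I

/-- The second idempotent component as a ring homomorphism. -/
noncomputable def proj₂ : Bicomplex →+* ℂ where
  toFun := P₂
  map_zero' := by simp [P₂]
  map_one' := by simp [P₂]
  map_add' z w := by simp only [P₂, w₁_add, w₂_add]; ring
  map_mul' z w := by
    simp only [P₂, w₁_mul, w₂_mul]
    linear_combination (-(z.w₂ * w.w₂)) * I_mul_I

/-- The idempotent representation as an isomorphism of real topological vector spaces. -/
noncomputable def components : Bicomplex ≃L[ℝ] ℂ × ℂ :=
  LinearEquiv.toContinuousLinearEquiv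
    { toFun := fun z => (P₁ z, P₂ z)
      invFun := fun p => idem p.1 p.2
      map_add' := fun z w => Prod.ext (map_add proj₁ z w) (map_add proj₂ z w)
      map_smul' := fun r z => by
        refine Prod.ext ?_ ?_ <;>
          simp only [P₁, P₂, w₁_smul, w₂_smul, Prod.smul_mk, RingHom.id_apply, real_smul] <;> ring
      left_inv := idem_P
      right_inv := fun p => Prod.ext (P₁_idem _ _) (P₂_idem _ _) }

/-- The properties shared by the two idempotent components: each is a continuous real-linear ring
homomorphism through which reciprocals, powers and Gamma values are computed. -/
structure IsComponent (π : Bicomplex →+* ℂ) : Prop where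
  exists_clm : ∃ L : Bicomplex →L[ℝ] ℂ, ∀ z, L z = π z
  map_inv : ∀ z, π z⁻¹ = (π z)⁻¹
  map_cpow : ∀ z w : Bicomplex, π (z ^ w) = π z ^ π w
  map_gamma : ∀ z, π (Bicomplex.Gamma z) = Complex.Gamma (π z)
  map_real : ∀ r : ℝ, π (r : Bicomplex) = r

theorem isComponent_proj₁ : IsComponent proj₁ where
  exists_clm := ⟨(ContinuousLinearMap.fst ℝ ℂ ℂ).comp components.toContinuousLinearMap,
    fun _ => rfl⟩
  map_inv z := P₁_idem _ _
  map_cpow z w := P₁_idem _ _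
  map_gamma z := P₁_idem _ _
  map_real r := by simp [proj₁, P₁, ofComplex]

theorem isComponent_proj₂ : IsComponent proj₂ where
  exists_clm := ⟨(ContinuousLinearMap.snd ℝ ℂ ℂ).comp components.toContinuousLinearMap,
    fun _ => rfl⟩
  map_inv z := P₂_idem _ _
  map_cpow z w := P₂_idem _ _
  map_gamma z := P₂_idem _ _
  map_real r := by simp [proj₂, P₂, ofComplex]

theorem map_div_component {π : Bicomplex →+* ℂ} (hπ : IsComponent π) (z w : Bicomplex) :
    π (z / w) = π z * (π w)⁻¹ := by
  rw [← hπ.map_inv, ← map_mul]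
  rfl

theorem map_prabhakar_term {π : Bicomplex →+* ℂ} (hπ : IsComponent π) (ς : ℝ)
    (τ δ z : Bicomplex) (k : ℕ) :
    π ((∏ i ∈ Finset.range k, (δ + (i : Bicomplex))) /
      ((k.factorial : Bicomplex) * Bicomplex.Gamma ((ς : Bicomplex) * (k : Bicomplex) + τ)) * z ^ k)
      = coeff ς (π τ) (π δ) k * π z ^ k := by
  rw [map_mul, map_div_component hπ, map_pow, map_prod, map_mul, hπ.map_gamma, map_add, map_mul,
    hπ.map_real, map_natCast, map_natCast, coeff, rising, div_eq_mul_inv]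
  simp only [map_add, map_natCast]

theorem summable_prabhakar {ς : ℝ} (hς : 0 < ς) (τ δ z : Bicomplex) :
    Summable fun k : ℕ => (∏ i ∈ Finset.range k, (δ + (i : Bicomplex))) /
      ((k.factorial : Bicomplex) * Bicomplex.Gamma ((ς : Bicomplex) * (k : Bicomplex) + τ))
      * z ^ k := by
  have hs : ∀ τ δ z : ℂ, Summable fun k : ℕ => coeff ς τ δ k * z ^ k := fun τ δ z => by
    refine Summable.of_norm ((summable_norm_coeff_mul_pow hς τ δ (norm_nonneg z)).congr fun k => ?_)
    rw [norm_mul, norm_pow]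
  rw [← components.summable]
  have h := ((hs (proj₁ τ) (proj₁ δ) (proj₁ z)).hasSum.prodMk
    (hs (proj₂ τ) (proj₂ δ) (proj₂ z)).hasSum).summable
  refine h.congr fun k => ?_
  exact Prod.ext (map_prabhakar_term isComponent_proj₁ ς τ δ z k).symm
    (map_prabhakar_term isComponent_proj₂ ς τ δ z k).symm

theorem map_prabhakar {π : Bicomplex →+* ℂ} (hπ : IsComponent π) {ς : ℝ} (hς : 0 < ς)
    (τ δ z : Bicomplex) :
    π (prabhakar ς τ δ z) = prabhakarC ς (π τ) (π δ) (π z) := by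
  obtain ⟨L, hL⟩ := hπ.exists_clm
  rw [prabhakar, ← hL, L.map_tsum (summable_prabhakar hς τ δ z), prabhakarC]
  exact tsum_congr fun k => (hL _).trans (map_prabhakar_term hπ ς τ δ z k)

theorem map_integrand {π : Bicomplex →+* ℂ} (hπ : IsComponent π) {ς : ℝ} (hς : 0 < ς)
    (ζ lam τ δ : Bicomplex) (t : ℝ) :
    π ((t : Bicomplex) ^ (ζ - 1) * prabhakar ς τ δ (-lam * (t : Bicomplex)))
      = (t : ℂ) ^ (π ζ - 1) * prabhakarC ς (π τ) (π δ) (-π lam * t) := by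
  rw [map_mul, hπ.map_cpow, map_prabhakar hπ hς, map_mul, map_neg, hπ.map_real, map_sub, map_one]

theorem map_value {π : Bicomplex →+* ℂ} (hπ : IsComponent π) (ς : ℝ) (ζ lam τ δ : Bicomplex) :
    π (Bicomplex.Gamma ζ * Bicomplex.Gamma (δ - ζ) /
        (Bicomplex.Gamma δ * Bicomplex.Gamma (τ - (ς : Bicomplex) * ζ)) * lam ^ (-ζ))
      = Complex.Gamma (π ζ) * Complex.Gamma (π δ - π ζ)
        * (Complex.Gamma (π δ) * Complex.Gamma (π τ - ς * π ζ))⁻¹ * π lam ^ (-π ζ) := by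
  rw [map_mul, map_div_component hπ, hπ.map_cpow, map_mul, map_mul, hπ.map_gamma, hπ.map_gamma,
    hπ.map_gamma, hπ.map_gamma, map_sub, map_sub, map_mul, map_neg, hπ.map_real]

theorem integrable_of_components {α : Type*} [MeasurableSpace α] {μ : Measure α}
    {f : α → Bicomplex} (h₁ : Integrable (fun a => proj₁ (f a)) μ)
    (h₂ : Integrable (fun a => proj₂ (f a)) μ) : Integrable f μ := by
  have h := components.symm.toContinuousLinearMap.integrable_comp (h₁.prodMk h₂)
  refine h.congr (Eventually.of_forall fun a => ?_)
  exact components.symm_apply_apply (f a)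

theorem component_of_tendsto {π : Bicomplex →+* ℂ} (hπ : IsComponent π) {ς : ℝ} (hς : 0 < ς)
    {ζ lam τ δ : Bicomplex} (hζ : 0 < (π ζ).re) (hζδ : (π ζ).re < (π δ).re)
    (hlam : π lam ∈ slitPlane)
    (hint : ∀ R : ℝ, 0 ≤ R → IntervalIntegrable (fun t : ℝ =>
      (t : Bicomplex) ^ (ζ - 1) * prabhakar ς τ δ (-lam * (t : Bicomplex))) volume 0 R)
    {J : Bicomplex}
    (hJ : Tendsto (fun R : ℝ => ∫ t in (0 : ℝ)..R,
      (t : Bicomplex) ^ (ζ - 1) * prabhakar ς τ δ (-lam * (t : Bicomplex))) atTop (𝓝 J)) :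
    π J = π (Bicomplex.Gamma ζ * Bicomplex.Gamma (δ - ζ) /
        (Bicomplex.Gamma δ * Bicomplex.Gamma (τ - (ς : Bicomplex) * ζ)) * lam ^ (-ζ)) := by
  rw [map_value hπ]
  refine value_of_tendsto hς hζ hζδ hlam ?_
  obtain ⟨L, hL⟩ := hπ.exists_clm
  rw [← hL J]
  refine ((L.continuous.tendsto J).comp hJ).congr' ?_
  filter_upwards [eventually_ge_atTop 0] with R hR
  rw [Function.comp_apply, ← L.intervalIntegral_comp_comm (hint R hR)]
  exact intervalIntegral.integral_congr fun t _ =>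
    (hL _).trans (map_integrand hπ hς ζ lam τ δ t)

theorem eq_of_components {z w : Bicomplex} (h₁ : proj₁ z = proj₁ w) (h₂ : proj₂ z = proj₂ w) :
    z = w :=
  components.injective (Prod.ext h₁ h₂)

end PrabhakarMellin

open PrabhakarMellin MeasureTheory

theorem mainTheorem5 (ς : ℝ) (hς : 0 < ς) (ζ lam τ δ : Bicomplex)
    (hδ : |δ.imj| < δ.re)
    (hζ₁ : 0 < ζ.P₁.re ∧ ζ.P₁.re < δ.P₁.re)
    (hζ₂ : 0 < ζ.P₂.re ∧ ζ.P₂.re < δ.P₂.re)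
    (hlam₁ : lam.P₁ ∈ Complex.slitPlane) (hlam₂ : lam.P₂ ∈ Complex.slitPlane) :
    -- whenever the improper integral converges, it has the stated value
    (∀ J : Bicomplex,
      Filter.Tendsto
        (fun R : ℝ => ∫ t in (0 : ℝ)..R,
          (t : Bicomplex) ^ (ζ - 1) * Bicomplex.prabhakar ς τ δ (-lam * (t : Bicomplex)))
        Filter.atTop (nhds J) →
      J = Bicomplex.Gamma ζ * Bicomplex.Gamma (δ - ζ) /
        (Bicomplex.Gamma δ * Bicomplex.Gamma (τ - (ς : Bicomplex) * ζ)) * lam ^ (-ζ)) ∧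
    -- and it converges absolutely in the sector below
    (|lam.P₁.arg| < (1 - ς / 2) * Real.pi → |lam.P₂.arg| < (1 - ς / 2) * Real.pi →
      MeasureTheory.IntegrableOn
        (fun t : ℝ =>
          (t : Bicomplex) ^ (ζ - 1) * Bicomplex.prabhakar ς τ δ (-lam * (t : Bicomplex)))
        (Set.Ioi 0) ∧
      ∫ t in Set.Ioi (0 : ℝ),
          (t : Bicomplex) ^ (ζ - 1) * Bicomplex.prabhakar ς τ δ (-lam * (t : Bicomplex)) =
        Bicomplex.Gamma ζ * Bicomplex.Gamma (δ - ζ) /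
          (Bicomplex.Gamma δ * Bicomplex.Gamma (τ - (ς : Bicomplex) * ζ)) * lam ^ (-ζ)) := by
  have hint : ∀ R : ℝ, 0 ≤ R → IntervalIntegrable (fun t : ℝ =>
      (t : Bicomplex) ^ (ζ - 1) * Bicomplex.prabhakar ς τ δ (-lam * (t : Bicomplex)))
      volume 0 R := by
    intro R hR
    rw [intervalIntegrable_iff_integrableOn_Ioc_of_le hR]
    refine integrable_of_components ?_ ?_
    · simp only [map_integrand isComponent_proj₁ hς]
      exact (intervalIntegrable_iff_integrableOn_Ioc_of_le hR).1
        (intervalIntegrable_cpow_mul_prabhakarC hς _ _ _ hζ₁.1 hR)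
    · simp only [map_integrand isComponent_proj₂ hς]
      exact (intervalIntegrable_iff_integrableOn_Ioc_of_le hR).1
        (intervalIntegrable_cpow_mul_prabhakarC hς _ _ _ hζ₂.1 hR)
  have hvalue : ∀ J : Bicomplex, Filter.Tendsto
      (fun R : ℝ => ∫ t in (0 : ℝ)..R,
        (t : Bicomplex) ^ (ζ - 1) * Bicomplex.prabhakar ς τ δ (-lam * (t : Bicomplex)))
      Filter.atTop (nhds J) →
      J = Bicomplex.Gamma ζ * Bicomplex.Gamma (δ - ζ) /
        (Bicomplex.Gamma δ * Bicomplex.Gamma (τ - (ς : Bicomplex) * ζ)) * lam ^ (-ζ) := fun J hJ =>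
    eq_of_components (component_of_tendsto isComponent_proj₁ hς hζ₁.1 hζ₁.2 hlam₁ hint hJ)
      (component_of_tendsto isComponent_proj₂ hς hζ₂.1 hζ₂.2 hlam₂ hint hJ)
  refine ⟨hvalue, fun harg₁ harg₂ => ?_⟩
  have habs : IntegrableOn (fun t : ℝ =>
      (t : Bicomplex) ^ (ζ - 1) * Bicomplex.prabhakar ς τ δ (-lam * (t : Bicomplex)))
      (Set.Ioi 0) := by
    refine integrable_of_components ?_ ?_
    · simp only [map_integrand isComponent_proj₁ hς]
      exact integrableOn_cpow_mul_prabhakarC hς _ hζ₁.1 hζ₁.2 hlam₁ harg₁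
    · simp only [map_integrand isComponent_proj₂ hς]
      exact integrableOn_cpow_mul_prabhakarC hς _ hζ₂.1 hζ₂.2 hlam₂ harg₂
  exact ⟨habs, hvalue _ (intervalIntegral_tendsto_integral_Ioi 0 habs Filter.tendsto_id)⟩
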